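/- Let $M$ be a smooth manifold of dimension $d\ge 2$ with a smooth Riemannian metric $\mathfrak g$ and a smooth weight $W:M\to\mathbb R$. Let $d\mu=e^{-W}dV_{\mathfrak g}$, where $V_{\mathfrak g}$ is the Riemannian volume, let $\Gamma(f)=|\nabla_{\mathfrak g}f|_{\mathfrak g}^2$ be the carré du champ operator, with associated bilinear form $\Gamma(f,h)=\mathfrak g(\nabla_{\mathfrak g}f,\nabla_{\mathfrak g}h)$, and let $L=\Delta_{\mathfrak g}-\Gamma(W,\cdot)$. The pair $(\mu,\Gamma)$ determines $\mathfrak g$, $W$ and $L$. For a real number $n$, the $n$-conformal class of $(\mu,\Gamma)$ is the set of all pairs $(c^{-n}\mu,c^2\Gamma)$ with $c:M\to(0,\infty)$ smooth; each of them is again the pair of a smooth metric and a smooth weight on $M$. An $n$-conformal invariant is a map $S$ from this class to the functions on $M$ such that, for every pair $(\mu,\Gamma)$ in the class (with its own $L$) and every smooth positive function $c=e^{\tau}$, $$S(c^{-n}\mu,c^2\Gamma)=c^2\Big[S(\mu,\Gamma)+\frac{n-2}{2}\Big(L\tau-\frac{n-2}{2}\Gamma(\tau)\Big)\Big].$$ Let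 $n>d$ be a real number and let $\gamma\in\mathbb R$ satisfy $4(d-1)-2\gamma(n-d)\neq 0$. Set $$\beta_n(\gamma)=\frac{\gamma(n-2d+2)-2(d-1)}{2(n-d)},\qquad \theta_n(\gamma)=\frac{n-2}{4(d-1)-2\gamma(n-d)}.$$ Then $$S_\gamma(\mu,\Gamma)=\theta_n(\gamma)\big[sc_{\mathfrak g}-\gamma\,\Delta_{\mathfrak g}W+\beta_n(\gamma)\,\Gamma(W)\big],$$ where $sc_{\mathfrak g}$ is the scalar curvature of $\mathfrak g$, is well defined as a function of the pair $(\mu,\Gamma)$ and is an $n$-conformal invariant. -/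

import Mathlib

open MeasureTheory Manifold
open scoped ContDiff

namespace WeightedManifold

noncomputable section

/-- The smooth real-valued functions on a `d`-dimensional manifold. -/
abbrev SmoothFun (d : ℕ) (M : Type*) [TopologicalSpace M]
    [ChartedSpace (EuclideanSpace ℝ (Fin d)) M] :=
  ContMDiffMap (𝓡 d) 𝓘(ℝ, ℝ) M ℝ ∞

/-- The smooth Riemannian metrics on a smooth `d`-dimensional manifold. -/
abbrev SmoothMetric (d : ℕ) (M : Type*) [TopologicalSpace M]
    [ChartedSpace (EuclideanSpace ℝ (Fin d)) M] [IsManifold (𝓡 d) ∞ M] :=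
  Bundle.ContMDiffRiemannianMetric (𝓡 d) ∞ (EuclideanSpace ℝ (Fin d))
    (fun x : M ↦ TangentSpace (𝓡 d) x)

/-- The partial derivative `∂_k F` of a function on `ℝᵈ`. -/
def pderiv {d : ℕ} (k : Fin d) (F : EuclideanSpace ℝ (Fin d) → ℝ)
    (y : EuclideanSpace ℝ (Fin d)) : ℝ :=
  fderiv ℝ F y (EuclideanSpace.single k 1)

/-! ### Riemannian quantities of a metric `G = (G_ij)` given on an open subset of `ℝᵈ` -/

/-- Christoffel symbols
`Γ^k_{ij} = ½ ∑_l G^{kl} (∂_i G_{jl} + ∂_j G_{il} - ∂_l G_{ij})`. -/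
def christoffel {d : ℕ} (G : EuclideanSpace ℝ (Fin d) → Matrix (Fin d) (Fin d) ℝ)
    (k i j : Fin d) (y : EuclideanSpace ℝ (Fin d)) : ℝ :=
  (1 / 2 : ℝ) * ∑ l, (G y)⁻¹ k l *
    (pderiv i (fun z ↦ G z j l) y + pderiv j (fun z ↦ G z i l) y - pderiv l (fun z ↦ G z i j) y)

/-- Ricci curvature
`R_{ij} = ∑_k (∂_k Γ^k_{ij} - ∂_j Γ^k_{ik}) + ∑_{k,l} (Γ^k_{kl} Γ^l_{ij} - Γ^k_{jl} Γ^l_{ik})`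
(the sign for which round spheres have positive curvature). -/
def ricci {d : ℕ} (G : EuclideanSpace ℝ (Fin d) → Matrix (Fin d) (Fin d) ℝ)
    (i j : Fin d) (y : EuclideanSpace ℝ (Fin d)) : ℝ :=
  (∑ k, (pderiv k (christoffel G k i j) y - pderiv j (christoffel G k i k) y)) +
    ∑ k, ∑ l, (christoffel G k k l y * christoffel G l i j y -
      christoffel G k j l y * christoffel G l i k y)

/-- Scalar curvature `∑_{i,j} G^{ij} R_{ij}`. -/
def localScalarCurvature {d : ℕ} (G : EuclideanSpace ℝ (Fin d) → Matrix (Fin d) (Fin d) ℝ)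
    (y : EuclideanSpace ℝ (Fin d)) : ℝ :=
  ∑ i, ∑ j, (G y)⁻¹ i j * ricci G i j y

/-- Laplace-Beltrami operator (trace of the Hessian)
`∑_{i,j} G^{ij} (∂_i ∂_j F - ∑_k Γ^k_{ij} ∂_k F)`. -/
def localLaplacian {d : ℕ} (G : EuclideanSpace ℝ (Fin d) → Matrix (Fin d) (Fin d) ℝ)
    (F : EuclideanSpace ℝ (Fin d) → ℝ) (y : EuclideanSpace ℝ (Fin d)) : ℝ :=
  ∑ i, ∑ j, (G y)⁻¹ i j *
    (pderiv i (pderiv j F) y - ∑ k, christoffel G k i j y * pderiv k F y)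

/-- Scalar product of gradients `∑_{i,j} G^{ij} ∂_i F ∂_j H`. -/
def localGradInner {d : ℕ} (G : EuclideanSpace ℝ (Fin d) → Matrix (Fin d) (Fin d) ℝ)
    (F H : EuclideanSpace ℝ (Fin d) → ℝ) (y : EuclideanSpace ℝ (Fin d)) : ℝ :=
  ∑ i, ∑ j, (G y)⁻¹ i j * (pderiv i F y * pderiv j H y)

section Manifold

variable {d : ℕ} {M : Type*} [TopologicalSpace M] [ChartedSpace (EuclideanSpace ℝ (Fin d)) M]

/-- A function on `M` read in the preferred chart at `x`. -/
def inChart (x : M) (f : M → ℝ) (y : EuclideanSpace ℝ (Fin d)) : ℝ :=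
  f ((chartAt (EuclideanSpace ℝ (Fin d)) x).symm y)

variable [IsManifold (𝓡 d) ∞ M]

/-- The matrix `G_ij = g(∂_i, ∂_j)` of the metric `g` in the preferred chart `φ` at `x`, as a
function on the target of `φ`; here `∂_i = d(φ⁻¹)(e_i)` are the coordinate vector fields. -/
def metricInChart (g : SmoothMetric d M) (x : M) (y : EuclideanSpace ℝ (Fin d)) :
    Matrix (Fin d) (Fin d) ℝ :=
  let φ := chartAt (EuclideanSpace ℝ (Fin d)) x
  let coordVec : Fin d → TangentSpace (𝓡 d) (φ.symm y) := fun i ↦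
    mfderiv 𝓘(ℝ, EuclideanSpace ℝ (Fin d)) (𝓡 d) φ.symm y
      (EuclideanSpace.single i (1 : ℝ) : EuclideanSpace ℝ (Fin d))
  Matrix.of fun i j ↦ g.inner (φ.symm y) (coordVec i) (coordVec j)

/-! The following quantities do not depend on coordinates; at each point they are computed in the
preferred chart at that point. -/

/-- The scalar curvature `sc_g`. -/
def scalarCurvature (g : SmoothMetric d M) (x : M) : ℝ :=
  localScalarCurvature (metricInChart g x) (chartAt (EuclideanSpace ℝ (Fin d)) x x)

/-- The Laplace-Beltrami operator `Δ_g`. -/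
def laplacian (g : SmoothMetric d M) (f : M → ℝ) (x : M) : ℝ :=
  localLaplacian (metricInChart g x) (inChart x f) (chartAt (EuclideanSpace ℝ (Fin d)) x x)

/-- The bilinear carré du champ `Γ(f, h) = g(∇f, ∇h)`; in particular `Γ(f, f) = |∇f|²`. -/
def gradInner (g : SmoothMetric d M) (f h : M → ℝ) (x : M) : ℝ :=
  localGradInner (metricInChart g x) (inChart x f) (inChart x h)
    (chartAt (EuclideanSpace ℝ (Fin d)) x x)

variable [MeasurableSpace M]

/-- The measure `√(det G) dy` of the preferred chart `φ` at `x`, transported by `φ⁻¹` to the domain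
of `φ` (and extended by zero to `M`). -/
def chartVolume (g : SmoothMetric d M) (x : M) : Measure M :=
  let φ := chartAt (EuclideanSpace ℝ (Fin d)) x
  Measure.map φ.symm ((volume.restrict φ.target).withDensity
    fun y ↦ ENNReal.ofReal (Real.sqrt (metricInChart g x y).det))

/-- The Riemannian volume `V_g`: the measure which on each chart domain equals `√(det G) dy`. By the
change of variables formula the chart measures agree on overlaps, so that the measure obtained by
gluing them is the least measure that dominates all of them. -/
def riemannianVolume (g : SmoothMetric d M) : Measure M :=
  ⨆ x : M, chartVolume g x

end Manifold

/-- A weighted Riemannian structure on the manifold `M`: a smooth metric `g` and a smooth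
weight `W`. -/
structure WeightedStructure (d : ℕ) (M : Type*) [TopologicalSpace M]
    [ChartedSpace (EuclideanSpace ℝ (Fin d)) M] [IsManifold (𝓡 d) ∞ M] where
  metric : SmoothMetric d M
  weight : SmoothFun d M

/-- Pairs `(μ, Γ)` of a measure on `M` and an operator `f ↦ Γ(f)` on smooth functions. Below, only
the pairs coming from weighted Riemannian structures matter. -/
@[ext] structure MeasureCarre (d : ℕ) (M : Type*) [TopologicalSpace M]
    [ChartedSpace (EuclideanSpace ℝ (Fin d)) M] [MeasurableSpace M] where
  measure : Measure M
  carre : SmoothFun d M → M → ℝ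

section Weighted

variable {d : ℕ} {M : Type*} [TopologicalSpace M] [ChartedSpace (EuclideanSpace ℝ (Fin d)) M]
  [MeasurableSpace M]

/-- The pair `(c^{-n} μ, c² Γ)`. -/
def MeasureCarre.conformal (T : MeasureCarre d M) (n : ℝ) (c : SmoothFun d M) :
    MeasureCarre d M where
  measure := T.measure.withDensity fun x ↦ ENNReal.ofReal (c x ^ (-n))
  carre := fun f x ↦ c x ^ 2 * T.carre f x

/-- The `n`-conformal class of `(μ, Γ)`: all `(c^{-n} μ, c² Γ)` with `c` smooth and positive. -/
def nConformalClass (n : ℝ) (T : MeasureCarre d M) : Set (MeasureCarre d M) :=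
  {T' | ∃ c : SmoothFun d M, (∀ x, 0 < c x) ∧ T' = T.conformal n c}

variable [IsManifold (𝓡 d) ∞ M]

namespace WeightedStructure

/-- The pair `(μ, Γ)` of a weighted manifold: `dμ = e^{-W} dV_g` and `Γ(f) = |∇f|²`. -/
def toPair (X : WeightedStructure d M) : MeasureCarre d M where
  measure := (riemannianVolume X.metric).withDensity fun x ↦
    ENNReal.ofReal (Real.exp (-X.weight x))
  carre := fun f x ↦ gradInner X.metric f f x

/-- The generator `L f = Δ_g f - Γ(W, f)`. -/
def generator (X : WeightedStructure d M) (f : M → ℝ) (x : M) : ℝ :=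
  laplacian X.metric f x - gradInner X.metric X.weight f x

end WeightedStructure

/-- `S` is an `n`-conformal invariant on the `n`-conformal class of (the pair of) `X`: for every
`(μ, Γ)` in this class, with metric and weight those of `Y`, and every smooth positive
`c = e^τ`,
`S(c^{-n} μ, c² Γ) = c² [S(μ, Γ) + (n-2)/2 (L τ - (n-2)/2 Γ(τ))]`. -/
def IsNConformalInvariant (n : ℝ) (X : WeightedStructure d M)
    (S : MeasureCarre d M → M → ℝ) : Prop :=
  ∀ Y : WeightedStructure d M, Y.toPair ∈ nConformalClass n X.toPair →
    ∀ c : SmoothFun d M, (∀ x, 0 < c x) → ∀ τ : SmoothFun d M, (∀ x, c x = Real.exp (τ x)) →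
      ∀ x, S (Y.toPair.conformal n c) x =
        c x ^ 2 * (S Y.toPair x + (n - 2) / 2 *
          (Y.generator τ x - (n - 2) / 2 * gradInner Y.metric τ τ x))

/-- `β_n(γ)`, in dimension `d`. -/
def beta (d : ℕ) (n γ : ℝ) : ℝ :=
  (γ * (n - 2 * d + 2) - 2 * (d - 1)) / (2 * (n - d))

/-- `θ_n(γ)`, in dimension `d`. -/
def theta (d : ℕ) (n γ : ℝ) : ℝ :=
  (n - 2) / (4 * (d - 1) - 2 * γ * (n - d))

/-- `θ_n(γ) [sc_g - γ Δ_g W + β_n(γ) Γ(W)]` for the weighted manifold `X`. -/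
def invariantFormula (n γ : ℝ) (X : WeightedStructure d M) (x : M) : ℝ :=
  theta d n γ * (scalarCurvature X.metric x - γ * laplacian X.metric X.weight x +
    beta d n γ * gradInner X.metric X.weight X.weight x)

open Classical in
/-- `S_γ` as a function of the pair `(μ, Γ)`: the value `θ_n(γ) [sc_g - γ Δ_g W + β_n(γ) Γ(W)]` for
the metric `g` and the weight `W` with `Γ(f) = |∇f|²` and `dμ = e^{-W} dV_g`
(and `0` for pairs that do not come from a weighted manifold). -/
def SGamma (n γ : ℝ) (T : MeasureCarre d M) : M → ℝ :=
  if h : ∃ X : WeightedStructure d M, X.toPair = T then invariantFormula n γ h.choose else 0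

end Weighted

end

end WeightedManifold


/-
Under `g ↦ e^{-2τ} g` the Christoffel symbols change by a tensor that is algebraic in `dτ` and `g`.
Inserting this tensor into the Palatini formula for the Ricci tensors of two connections gives the
conformal change of the scalar curvature, and contracting it gives that of the Laplacian. The volume
form is multiplied by `e^{-dτ}`, so `(c^{-n} μ, c² Γ)` with `c = e^τ` is the pair of the metric
`e^{-2τ} g` and the weight `W + (n - d) τ`. Expanding the formula for `S_γ` at this new pair, the
coefficient `β_n(γ)` is the one that cancels the terms in `Γ(W, τ)` other than those of `L τ`, and
`θ_n(γ)` normalizes the coefficient of `Δτ`.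

That a pair determines its metric follows by polarization from functions with prescribed gradient
at a point; it determines its weight because the Riemannian volume is locally finite and positive
on nonempty open sets, so that continuous densities with respect to it are unique.
-/

namespace WeightedManifold

local notation:max "E[" d "]" => EuclideanSpace ℝ (Fin d)

section PartialDerivatives

variable {d : ℕ} {k : Fin d} {F H : E[d] → ℝ} {U : Set E[d]} {y : E[d]}

theorem pderiv_add (hF : DifferentiableAt ℝ F y) (hH : DifferentiableAt ℝ H y) :
    pderiv k (fun z ↦ F z + H z) y = pderiv k F y + pderiv k H y := by
  simp [pderiv, fderiv_fun_add hF hH]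

theorem pderiv_sub (hF : DifferentiableAt ℝ F y) (hH : DifferentiableAt ℝ H y) :
    pderiv k (fun z ↦ F z - H z) y = pderiv k F y - pderiv k H y := by
  simp [pderiv, fderiv_fun_sub hF hH]

theorem pderiv_mul (hF : DifferentiableAt ℝ F y) (hH : DifferentiableAt ℝ H y) :
    pderiv k (fun z ↦ F z * H z) y = pderiv k F y * H y + F y * pderiv k H y := by
  simp [pderiv, fderiv_fun_mul hF hH, add_comm, mul_comm]

theorem pderiv_const_mul (a : ℝ) (hF : DifferentiableAt ℝ F y) :
    pderiv k (fun z ↦ a * F z) y = a * pderiv k F y := by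
  simp [pderiv, fderiv_const_mul hF]

theorem pderiv_sum {ι : Type*} {s : Finset ι} {F : ι → E[d] → ℝ}
    (hF : ∀ i ∈ s, DifferentiableAt ℝ (F i) y) :
    pderiv k (fun z ↦ ∑ i ∈ s, F i z) y = ∑ i ∈ s, pderiv k (F i) y := by
  simp [pderiv, fderiv_fun_sum hF]

theorem pderiv_exp (hF : DifferentiableAt ℝ F y) :
    pderiv k (fun z ↦ Real.exp (F z)) y = Real.exp (F y) * pderiv k F y := by
  simp [pderiv, fderiv_exp hF]

theorem pderiv_congr (h : F =ᶠ[nhds y] H) : pderiv k F y = pderiv k H y := by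
  rw [pderiv, pderiv, h.fderiv_eq]

theorem pderiv_congr_of_eqOn (hU : IsOpen U) (h : Set.EqOn F H U) (hy : y ∈ U) :
    pderiv k F y = pderiv k H y :=
  pderiv_congr (h.eventuallyEq_of_mem (hU.mem_nhds hy))

theorem differentiableAt_of_contDiffOn (hU : IsOpen U) (hF : ContDiffOn ℝ ∞ F U) (hy : y ∈ U) :
    DifferentiableAt ℝ F y :=
  (hF.contDiffAt (hU.mem_nhds hy)).differentiableAt (by simp)

theorem contDiffOn_pderiv (hU : IsOpen U) (hF : ContDiffOn ℝ ∞ F U) (k : Fin d) :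
    ContDiffOn ℝ ∞ (pderiv k F) U :=
  (hF.fderiv_of_isOpen hU (by simp)).clm_apply contDiffOn_const

theorem pderiv_comm (hF : ContDiffAt ℝ 2 F y) (i j : Fin d) :
    pderiv i (pderiv j F) y = pderiv j (pderiv i F) y := by
  have hF' : DifferentiableAt ℝ (fderiv ℝ F) y :=
    (hF.fderiv_right (m := 1) (by norm_num)).differentiableAt one_ne_zero
  have pderiv_pderiv (a b : Fin d) : pderiv a (pderiv b F) y =
      fderiv ℝ (fderiv ℝ F) y (EuclideanSpace.single a 1) (EuclideanSpace.single b 1) := by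
    unfold pderiv
    simp [fderiv_clm_apply hF' (differentiableAt_const _)]
  rw [pderiv_pderiv, pderiv_pderiv]
  exact hF.isSymmSndFDerivAt (by simp) _ _

end PartialDerivatives

theorem contDiffOn_det {V ι : Type*} [NormedAddCommGroup V] [NormedSpace ℝ V] [Fintype ι]
    [DecidableEq ι] {n : WithTop ℕ∞} {A : V → Matrix ι ι ℝ} {U : Set V}
    (hA : ∀ i j, ContDiffOn ℝ n (fun y ↦ A y i j) U) : ContDiffOn ℝ n (fun y ↦ (A y).det) U := by
  simp only [Matrix.det_apply]
  exact ContDiffOn.sum fun σ _ ↦ (contDiffOn_prod fun i _ ↦ hA _ _).const_smul _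

theorem contDiffOn_adjugate {V ι : Type*} [NormedAddCommGroup V] [NormedSpace ℝ V] [Fintype ι]
    [DecidableEq ι] {n : WithTop ℕ∞} {A : V → Matrix ι ι ℝ} {U : Set V}
    (hA : ∀ i j, ContDiffOn ℝ n (fun y ↦ A y i j) U) (i j : ι) :
    ContDiffOn ℝ n (fun y ↦ (A y).adjugate i j) U := by
  simp only [Matrix.adjugate_apply]
  refine contDiffOn_det fun a b ↦ ?_
  simp only [Matrix.updateRow_apply]
  split_ifs
  exacts [contDiffOn_const, hA a b]

/-- The components of a smooth metric on an open set `U`, given as a field of symmetric invertible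
matrices. Positivity is not required. -/
structure IsLocalMetricOn {d : ℕ} (G : E[d] → Matrix (Fin d) (Fin d) ℝ) (U : Set E[d]) : Prop where
  isOpen : IsOpen U
  contDiffOn : ∀ i j, ContDiffOn ℝ ∞ (fun y ↦ G y i j) U
  isSymm : ∀ y ∈ U, (G y).IsSymm
  isUnit_det : ∀ y ∈ U, IsUnit (G y).det

namespace IsLocalMetricOn

variable {d : ℕ} {G : E[d] → Matrix (Fin d) (Fin d) ℝ} {U : Set E[d]} {y : E[d]}

theorem differentiableAt (hG : IsLocalMetricOn G U) (hy : y ∈ U) (i j : Fin d) :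
    DifferentiableAt ℝ (fun z ↦ G z i j) y :=
  differentiableAt_of_contDiffOn hG.isOpen (hG.contDiffOn i j) hy

theorem contDiffOn_inv (hG : IsLocalMetricOn G U) (i j : Fin d) :
    ContDiffOn ℝ ∞ (fun y ↦ (G y)⁻¹ i j) U := by
  have hdet : ContDiffOn ℝ ∞ (fun y ↦ (G y).det⁻¹) U :=
    (contDiffOn_det hG.contDiffOn).inv fun y hy ↦ (hG.isUnit_det y hy).ne_zero
  exact (hdet.mul (contDiffOn_adjugate hG.contDiffOn i j)).congr fun y _ ↦ by simp [Matrix.inv_def]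

theorem isSymm_inv (hG : IsLocalMetricOn G U) (hy : y ∈ U) : (G y)⁻¹.IsSymm :=
  (hG.isSymm y hy).inv

theorem sum_inv_mul (hG : IsLocalMetricOn G U) (hy : y ∈ U) (i j : Fin d) :
    ∑ l, (G y)⁻¹ i l * G y l j = if i = j then 1 else 0 := by
  rw [← Matrix.mul_apply, Matrix.nonsing_inv_mul _ (hG.isUnit_det y hy), Matrix.one_apply]

theorem sum_mul_inv (hG : IsLocalMetricOn G U) (hy : y ∈ U) (i j : Fin d) :
    ∑ l, G y i l * (G y)⁻¹ l j = if i = j then 1 else 0 := by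
  rw [← Matrix.mul_apply, Matrix.mul_nonsing_inv _ (hG.isUnit_det y hy), Matrix.one_apply]

theorem sum_inv_mul_self (hG : IsLocalMetricOn G U) (hy : y ∈ U) :
    ∑ i, ∑ j, (G y)⁻¹ i j * G y i j = d := by
  have hrow (i : Fin d) : ∑ j, (G y)⁻¹ i j * G y i j = 1 := by
    simpa only [(hG.isSymm y hy).apply i, if_true] using hG.sum_inv_mul hy i i
  simp [hrow]

theorem pderiv_comm_index (hG : IsLocalMetricOn G U) (hy : y ∈ U) (k i j : Fin d) :
    pderiv k (fun z ↦ G z i j) y = pderiv k (fun z ↦ G z j i) y :=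
  pderiv_congr_of_eqOn hG.isOpen (fun z hz ↦ (hG.isSymm z hz).apply j i) hy

theorem christoffel_symm (hG : IsLocalMetricOn G U) (hy : y ∈ U) (k i j : Fin d) :
    christoffel G k i j y = christoffel G k j i y := by
  simp only [christoffel, hG.pderiv_comm_index hy _ i j, add_comm (pderiv i _ y)]

theorem contDiffOn_christoffel (hG : IsLocalMetricOn G U) (k i j : Fin d) :
    ContDiffOn ℝ ∞ (christoffel G k i j) U := by
  have hdG (a b c : Fin d) : ContDiffOn ℝ ∞ (pderiv a fun z ↦ G z b c) U :=
    contDiffOn_pderiv hG.isOpen (hG.contDiffOn b c) a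
  exact contDiffOn_const.mul <| ContDiffOn.sum fun l _ ↦
    (hG.contDiffOn_inv k l).mul (((hdG i j l).add (hdG j i l)).sub (hdG l i j))

theorem sum_mul_christoffel (hG : IsLocalMetricOn G U) (hy : y ∈ U) (m i j : Fin d) :
    ∑ k, G y m k * christoffel G k i j y = (1 / 2 : ℝ) *
      (pderiv i (fun z ↦ G z j m) y + pderiv j (fun z ↦ G z i m) y
        - pderiv m (fun z ↦ G z i j) y) := by
  simp only [christoffel, mul_left_comm _ (1 / 2 : ℝ), ← Finset.mul_sum]
  congr 1
  simp only [Finset.mul_sum, ← mul_assoc]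
  rw [Finset.sum_comm]
  simp [← Finset.sum_mul, hG.sum_mul_inv hy]

theorem pderiv_eq_sum_christoffel (hG : IsLocalMetricOn G U) (hy : y ∈ U) (k i j : Fin d) :
    pderiv k (fun z ↦ G z i j) y =
      ∑ l, (G y i l * christoffel G l k j y + G y j l * christoffel G l k i y) := by
  rw [Finset.sum_add_distrib, hG.sum_mul_christoffel hy, hG.sum_mul_christoffel hy,
    hG.pderiv_comm_index hy k j i, hG.pderiv_comm_index hy i k j]
  ring

end IsLocalMetricOn

noncomputable section

/-- The components `∇_m v^k = ∂_m v^k + ∑_l Γ^k_{ml} v^l` of the covariant derivative of a vector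
field. -/
def covDeriv {d : ℕ} (G : E[d] → Matrix (Fin d) (Fin d) ℝ) (v : Fin d → E[d] → ℝ) (m k : Fin d)
    (y : E[d]) : ℝ :=
  pderiv m (v k) y + ∑ l, christoffel G k m l y * v l y

/-- The components `∇_m w_i = ∂_m w_i - ∑_l Γ^l_{mi} w_l` of the covariant derivative of a
`1`-form. -/
def covDerivForm {d : ℕ} (G : E[d] → Matrix (Fin d) (Fin d) ℝ) (w : Fin d → E[d] → ℝ) (m i : Fin d)
    (y : E[d]) : ℝ :=
  pderiv m (w i) y - ∑ l, christoffel G l m i y * w l y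

/-- The components `∇_m A^k_{ij}` of the covariant derivative of a tensor field with one upper and
two lower indices. -/
def covDerivTensor {d : ℕ} (G : E[d] → Matrix (Fin d) (Fin d) ℝ)
    (A : Fin d → Fin d → Fin d → E[d] → ℝ) (m k i j : Fin d) (y : E[d]) : ℝ :=
  pderiv m (A k i j) y + ∑ l, (christoffel G k m l y * A l i j y -
    christoffel G l m i y * A k l j y - christoffel G l m j y * A k i l y)

/-- The components `∇_i ∇_j F` of the Hessian. -/
def localHessian {d : ℕ} (G : E[d] → Matrix (Fin d) (Fin d) ℝ) (F : E[d] → ℝ) (i j : Fin d)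
    (y : E[d]) : ℝ :=
  covDerivForm G (fun k ↦ pderiv k F) i j y

/-- The components `∑_l G^{kl} ∂_l F` of the gradient. -/
def localGrad {d : ℕ} (G : E[d] → Matrix (Fin d) (Fin d) ℝ) (F : E[d] → ℝ) (k : Fin d) (y : E[d]) :
    ℝ :=
  ∑ l, (G y)⁻¹ k l * pderiv l F y

end

section CovariantDerivative

variable {d : ℕ} {G : E[d] → Matrix (Fin d) (Fin d) ℝ} {U : Set E[d]} {F H : E[d] → ℝ} {y : E[d]}

theorem localLaplacian_eq_sum_localHessian :
    localLaplacian G F y = ∑ i, ∑ j, (G y)⁻¹ i j * localHessian G F i j y :=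
  rfl

theorem localGradInner_eq_sum_localGrad :
    localGradInner G F H y = ∑ i, pderiv i F y * localGrad G H i y := by
  simp only [localGradInner, localGrad, Finset.mul_sum, mul_left_comm]

namespace IsLocalMetricOn

theorem localHessian_symm (hG : IsLocalMetricOn G U) (hF : ContDiffOn ℝ ∞ F U) (hy : y ∈ U)
    (i j : Fin d) : localHessian G F i j y = localHessian G F j i y := by
  have hF' : ContDiffAt ℝ 2 F y :=
    (hF.contDiffAt (hG.isOpen.mem_nhds hy)).of_le (by norm_cast)
  simp only [localHessian, covDerivForm, pderiv_comm hF' i j, hG.christoffel_symm hy _ i j]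

theorem localGradInner_comm (hG : IsLocalMetricOn G U) (hy : y ∈ U) :
    localGradInner G F H y = localGradInner G H F y := by
  rw [localGradInner, Finset.sum_comm, localGradInner]
  simp only [(hG.isSymm_inv hy).apply, mul_comm (pderiv _ F y)]

theorem contDiffOn_localGrad (hG : IsLocalMetricOn G U) (hF : ContDiffOn ℝ ∞ F U) (k : Fin d) :
    ContDiffOn ℝ ∞ (localGrad G F k) U :=
  ContDiffOn.sum fun l _ ↦ (hG.contDiffOn_inv k l).mul (contDiffOn_pderiv hG.isOpen hF l)

theorem sum_mul_localGrad (hG : IsLocalMetricOn G U) (hy : y ∈ U) (i : Fin d) :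
    ∑ k, G y i k * localGrad G F k y = pderiv i F y := by
  simp only [localGrad, Finset.mul_sum, ← mul_assoc]
  rw [Finset.sum_comm]
  simp [← Finset.sum_mul, hG.sum_mul_inv hy]

theorem sum_mul_covDeriv (hG : IsLocalMetricOn G U) {v : Fin d → E[d] → ℝ}
    (hv : ∀ k, DifferentiableAt ℝ (v k) y) (hy : y ∈ U) (m i : Fin d) :
    ∑ k, G y i k * covDeriv G v m k y = covDerivForm G (fun i z ↦ ∑ k, G z i k * v k z) m i y := by
  have hmul (k : Fin d) : DifferentiableAt ℝ (fun z ↦ G z i k * v k z) y :=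
    (hG.differentiableAt hy i k).mul (hv k)
  have swap : ∑ k, ∑ l, G y i k * (christoffel G k m l y * v l y) =
      ∑ k, ∑ l, G y i l * christoffel G l m k y * v k y := by
    rw [Finset.sum_comm]
    simp only [mul_assoc]
  have cancel : ∑ l, ∑ k, christoffel G l m i y * (G y l k * v k y) =
      ∑ k, ∑ l, G y k l * christoffel G l m i y * v k y := by
    rw [Finset.sum_comm]
    refine Finset.sum_congr rfl fun k _ ↦ Finset.sum_congr rfl fun l _ ↦ ?_
    rw [(hG.isSymm y hy).apply k l]
    ring
  simp only [covDeriv, covDerivForm, pderiv_sum fun k _ ↦ hmul k,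
    pderiv_mul (hG.differentiableAt hy i _) (hv _), hG.pderiv_eq_sum_christoffel hy m i,
    mul_add, Finset.mul_sum, Finset.sum_mul, Finset.sum_add_distrib, add_mul, swap, cancel]
  ring

theorem sum_mul_covDeriv_localGrad (hG : IsLocalMetricOn G U) (hF : ContDiffOn ℝ ∞ F U)
    (hy : y ∈ U) (m i : Fin d) :
    ∑ k, G y i k * covDeriv G (localGrad G F) m k y = localHessian G F m i y := by
  have hgrad (k : Fin d) :=
    differentiableAt_of_contDiffOn hG.isOpen (hG.contDiffOn_localGrad hF k) hy
  rw [hG.sum_mul_covDeriv hgrad hy, localHessian, covDerivForm, covDerivForm,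
    pderiv_congr_of_eqOn hG.isOpen (fun z hz ↦ hG.sum_mul_localGrad hz i) hy]
  simp only [hG.sum_mul_localGrad hy]

theorem sum_covDeriv_localGrad (hG : IsLocalMetricOn G U) (hF : ContDiffOn ℝ ∞ F U) (hy : y ∈ U) :
    ∑ k, covDeriv G (localGrad G F) k k y = localLaplacian G F y := by
  simp only [localLaplacian_eq_sum_localHessian, ← hG.sum_mul_covDeriv_localGrad hF hy,
    Finset.mul_sum, ← mul_assoc]
  refine Finset.sum_congr rfl fun i _ ↦ ?_
  rw [Finset.sum_comm]
  simp [← Finset.sum_mul, hG.sum_inv_mul hy]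

end IsLocalMetricOn

theorem ricci_of_christoffel_eq_add {G' : E[d] → Matrix (Fin d) (Fin d) ℝ}
    {A : Fin d → Fin d → Fin d → E[d] → ℝ} (hG : IsLocalMetricOn G U)
    (hA : ∀ k i j, DifferentiableAt ℝ (A k i j) y) (hsymm : ∀ k i j, A k i j y = A k j i y)
    (h : ∀ k i j, Set.EqOn (christoffel G' k i j) (christoffel G k i j + A k i j) U) (hy : y ∈ U)
    (i j : Fin d) :
    ricci G' i j y = ricci G i j y +
      ∑ k, (covDerivTensor G A k k i j y - covDerivTensor G A j k i k y) +
      ∑ k, ∑ l, (A k k l y * A l i j y - A k j l y * A l i k y) := by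
  have hpderiv (m k i j : Fin d) : pderiv m (christoffel G' k i j) y =
      pderiv m (christoffel G k i j) y + pderiv m (A k i j) y :=
    (pderiv_congr_of_eqOn hG.isOpen (h k i j) hy).trans <| pderiv_add
      (differentiableAt_of_contDiffOn hG.isOpen (hG.contDiffOn_christoffel k i j) hy) (hA k i j)
  simp only [ricci, covDerivTensor, hpderiv, h _ _ _ hy, Pi.add_apply, ← Finset.sum_add_distrib]
  refine Finset.sum_congr rfl fun k _ ↦ ?_
  have hquadratic (l : Fin d) :
      (christoffel G k k l y + A k k l y) * (christoffel G l i j y + A l i j y) -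
        (christoffel G k j l y + A k j l y) * (christoffel G l i k y + A l i k y) =
      (christoffel G k k l y * christoffel G l i j y -
        christoffel G k j l y * christoffel G l i k y) +
      ((christoffel G k k l y * A l i j y - christoffel G l k i y * A k l j y -
          christoffel G l k j y * A k i l y) -
        (christoffel G k j l y * A l i k y - christoffel G l j i y * A k l k y -
          christoffel G l j k y * A k i l y)) +
      (A k k l y * A l i j y - A k j l y * A l i k y) := by
    rw [hG.christoffel_symm hy l k i, hG.christoffel_symm hy l k j, hG.christoffel_symm hy l j i,
      hsymm k l j, hsymm k l k]
    ring
  simp only [hquadratic, Finset.sum_add_distrib, Finset.sum_sub_distrib]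
  ring

end CovariantDerivative

section ConformalTensor

variable {R ι : Type*} [CommRing R] [DecidableEq ι]

/-- The tensor `A^k_{ij} = g_{ij} v^k - δ^k_j w_i - δ^k_i w_j`, by which the Christoffel symbols
change when the metric `g` is rescaled conformally. -/
def conformalTensor (g : Matrix ι ι R) (v w : ι → R) (k i j : ι) : R :=
  g i j * v k - ((if k = j then w i else 0) + if k = i then w j else 0)

variable {g : Matrix ι ι R} {v w : ι → R}

theorem conformalTensor_symm (hg : g.IsSymm) (k i j : ι) :
    conformalTensor g v w k i j = conformalTensor g v w k j i := by
  rw [conformalTensor, conformalTensor, hg.apply i j, add_comm (ite _ _ _)]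

variable [Fintype ι]

theorem sum_mul_conformalTensor (u : ι → R) (i j : ι) :
    ∑ k, u k * conformalTensor g v w k i j = g i j * ∑ k, u k * v k - (u j * w i + u i * w j) := by
  simp [conformalTensor, mul_sub, mul_add, Finset.sum_add_distrib, Finset.mul_sum, mul_left_comm]

theorem sum_mul_conformalTensor_left (u : ι → R) (k j : ι) :
    ∑ l, u l * conformalTensor g v w k l j =
      (∑ l, u l * g l j) * v k - ((if k = j then ∑ l, u l * w l else 0) + u k * w j) := by
  simp only [conformalTensor, mul_sub, mul_add, Finset.sum_sub_distrib, Finset.sum_add_distrib,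
    Finset.sum_mul, mul_assoc]
  split_ifs <;> simp

theorem trace_conformalTensor (hw : ∀ i, ∑ k, g i k * v k = w i) (i : ι) :
    ∑ k, conformalTensor g v w k i k = -Fintype.card ι * w i := by
  simp [conformalTensor, Finset.sum_add_distrib, hw]

theorem sum_conformalTensor_mul_swap (hg : g.IsSymm) (hw : ∀ i, ∑ k, g i k * v k = w i) (i j : ι) :
    ∑ k, ∑ l, conformalTensor g v w k j l * conformalTensor g v w l i k =
      (Fintype.card ι + 2) * (w i * w j) - 2 * (g i j * ∑ k, w k * v k) := by
  have expand (k : ι) : ∑ l, conformalTensor g v w k j l * conformalTensor g v w l i k =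
      v k * ∑ l, g j l * conformalTensor g v w l i k - w j * conformalTensor g v w k i k -
        if k = j then ∑ l, w l * conformalTensor g v w l i k else 0 := by
    conv_lhs => simp only [conformalTensor.eq_1 g v w k j]
    split_ifs <;>
      simp [sub_mul, add_mul, Finset.sum_add_distrib, Finset.mul_sum, mul_assoc, mul_left_comm]
    ring
  have lowered : ∑ k, v k * ∑ l, g j l * conformalTensor g v w l i k =
      -(g i j * ∑ k, w k * v k) := by
    have hterm (k : ι) : v k * (g i k * w j - (g j k * w i + g j i * w k)) =
        g i k * v k * w j - g j k * v k * w i - g i j * (w k * v k) := by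
      rw [hg.apply i j]
      ring
    simp only [sum_mul_conformalTensor, hw, hterm, Finset.sum_sub_distrib, ← Finset.sum_mul,
      ← Finset.mul_sum]
    ring
  simp only [expand, Finset.sum_sub_distrib]
  rw [lowered]
  simp only [← Finset.mul_sum, trace_conformalTensor hw, Finset.sum_ite_eq', Finset.mem_univ,
    if_true, sum_mul_conformalTensor]
  ring

theorem sum_conformalTensor_mul_sub (hg : g.IsSymm) (hw : ∀ i, ∑ k, g i k * v k = w i) (i j : ι) :
    ∑ k, ∑ l, (conformalTensor g v w k k l * conformalTensor g v w l i j -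
      conformalTensor g v w k j l * conformalTensor g v w l i k) =
    (Fintype.card ι - 2) * (w i * w j - g i j * ∑ k, w k * v k) := by
  have traced : ∑ k, ∑ l, conformalTensor g v w k k l * conformalTensor g v w l i j =
      -Fintype.card ι * (g i j * ∑ k, w k * v k - 2 * (w i * w j)) := by
    have htrace (l : ι) : ∑ k, conformalTensor g v w k k l = -Fintype.card ι * w l := by
      rw [← trace_conformalTensor hw]
      exact Finset.sum_congr rfl fun k _ ↦ conformalTensor_symm hg k k l
    rw [Finset.sum_comm]
    simp only [← Finset.sum_mul, htrace, mul_assoc, ← Finset.mul_sum, sum_mul_conformalTensor]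
    ring
  simp only [Finset.sum_sub_distrib, traced, sum_conformalTensor_mul_swap hg hw]
  ring

end ConformalTensor

section ConformalChange

noncomputable section

/-- The metric `e^{-2F} G`. -/
def expScale {d : ℕ} (G : E[d] → Matrix (Fin d) (Fin d) ℝ) (F : E[d] → ℝ) (y : E[d]) :
    Matrix (Fin d) (Fin d) ℝ :=
  Real.exp (-2 * F y) • G y

/-- The difference `G_{ij} ∇^k F - δ^k_j ∂_i F - δ^k_i ∂_j F` of the Christoffel symbols of
`e^{-2F} G` and of `G`. -/
def christoffelDiff {d : ℕ} (G : E[d] → Matrix (Fin d) (Fin d) ℝ) (F : E[d] → ℝ)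
    (k i j : Fin d) (y : E[d]) : ℝ :=
  conformalTensor (G y) (fun k ↦ localGrad G F k y) (fun i ↦ pderiv i F y) k i j

end

variable {d : ℕ} {G : E[d] → Matrix (Fin d) (Fin d) ℝ} {U : Set E[d]} {F H : E[d] → ℝ} {y : E[d]}

namespace IsLocalMetricOn

theorem covDerivTensor_conformalTensor (hG : IsLocalMetricOn G U) {v w : Fin d → E[d] → ℝ}
    (hv : ∀ k, DifferentiableAt ℝ (v k) y) (hw : ∀ k, DifferentiableAt ℝ (w k) y) (hy : y ∈ U)
    (m k i j : Fin d) :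
    covDerivTensor G (fun k i j z ↦ conformalTensor (G z) (v · z) (w · z) k i j) m k i j y =
      conformalTensor (G y) (covDeriv G v m · y) (covDerivForm G w m · y) k i j := by
  have hpderiv : pderiv m (fun z ↦ conformalTensor (G z) (v · z) (w · z) k i j) y =
      pderiv m (fun z ↦ G z i j) y * v k y + G y i j * pderiv m (v k) y -
        ((if k = j then pderiv m (w i) y else 0) + if k = i then pderiv m (w j) y else 0) := by
    have hgv : DifferentiableAt ℝ (fun z ↦ G z i j * v k z) y :=
      (hG.differentiableAt hy i j).mul (hv k)
    unfold conformalTensor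
    split_ifs <;>
      simp [pderiv_sub, pderiv_add, pderiv_mul, hgv, hw, hv, hG.differentiableAt hy i j]
  have hupper : ∑ l, christoffel G k m l y * conformalTensor (G y) (v · y) (w · y) l i j = _ :=
    sum_mul_conformalTensor _ i j
  have hlower (i j : Fin d) :
      ∑ l, christoffel G l m i y * conformalTensor (G y) (v · y) (w · y) k l j = _ :=
    sum_mul_conformalTensor_left _ k j
  have hcompat : pderiv m (fun z ↦ G z i j) y =
      ∑ l, christoffel G l m i y * G y l j + ∑ l, christoffel G l m j y * G y l i := by
    simp only [hG.pderiv_eq_sum_christoffel hy, Finset.sum_add_distrib,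
      (hG.isSymm y hy).apply i, (hG.isSymm y hy).apply j, mul_comm (G y _ _)]
    exact add_comm _ _
  simp only [covDerivTensor, Finset.sum_sub_distrib, conformalTensor_symm (hG.isSymm y hy) k i,
    hupper, hlower]
  rw [hpderiv, hcompat]
  simp only [conformalTensor, covDeriv, covDerivForm, (hG.isSymm y hy).apply i j]
  split_ifs <;> ring

theorem expScale_inv (hG : IsLocalMetricOn G U) (hy : y ∈ U) :
    (expScale G F y)⁻¹ = Real.exp (2 * F y) • (G y)⁻¹ := by
  refine Matrix.inv_eq_left_inv ?_
  rw [expScale, Matrix.smul_mul, Matrix.mul_smul, Matrix.nonsing_inv_mul _ (hG.isUnit_det y hy),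
    smul_smul, ← Real.exp_add]
  simp

theorem pderiv_expScale (hG : IsLocalMetricOn G U) (hF : DifferentiableAt ℝ F y) (hy : y ∈ U)
    (k i j : Fin d) :
    pderiv k (fun z ↦ expScale G F z i j) y =
      Real.exp (-2 * F y) * (pderiv k (fun z ↦ G z i j) y - 2 * pderiv k F y * G y i j) := by
  simp only [expScale, Matrix.smul_apply, smul_eq_mul]
  rw [pderiv_mul (hF.const_mul _).exp (hG.differentiableAt hy i j), pderiv_exp (hF.const_mul _),
    pderiv_const_mul _ hF]
  ring

theorem christoffel_expScale (hG : IsLocalMetricOn G U) (hF : DifferentiableAt ℝ F y) (hy : y ∈ U)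
    (k i j : Fin d) :
    christoffel (expScale G F) k i j y = christoffel G k i j y + christoffelDiff G F k i j y := by
  have hexp : Real.exp (2 * F y) * Real.exp (-2 * F y) = 1 := by simp [← Real.exp_add]
  have hterm (l : Fin d) : (expScale G F y)⁻¹ k l * (pderiv i (fun z ↦ expScale G F z j l) y +
      pderiv j (fun z ↦ expScale G F z i l) y - pderiv l (fun z ↦ expScale G F z i j) y) =
      (G y)⁻¹ k l * (pderiv i (fun z ↦ G z j l) y + pderiv j (fun z ↦ G z i l) y
        - pderiv l (fun z ↦ G z i j) y)
      - 2 * (((G y)⁻¹ k l * G y l j) * pderiv i F y + ((G y)⁻¹ k l * G y l i) * pderiv j F y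
        - G y i j * ((G y)⁻¹ k l * pderiv l F y)) := by
    simp only [hG.expScale_inv hy, hG.pderiv_expScale hF hy, (hG.isSymm y hy).apply l,
      Matrix.smul_apply, smul_eq_mul]
    linear_combination ((G y)⁻¹ k l * (pderiv i (fun z ↦ G z j l) y + pderiv j (fun z ↦ G z i l) y
        - pderiv l (fun z ↦ G z i j) y - 2 * (G y l j * pderiv i F y + G y l i * pderiv j F y -
        G y i j * pderiv l F y))) * hexp
  simp only [christoffel, christoffelDiff, conformalTensor, localGrad, hterm,
    Finset.sum_sub_distrib, Finset.sum_add_distrib, ← Finset.mul_sum, ← Finset.sum_mul,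
    hG.sum_inv_mul hy]
  split_ifs <;> ring

theorem differentiableAt_christoffelDiff (hG : IsLocalMetricOn G U) (hF : ContDiffOn ℝ ∞ F U)
    (hy : y ∈ U) (k i j : Fin d) : DifferentiableAt ℝ (christoffelDiff G F k i j) y := by
  have hgrad := differentiableAt_of_contDiffOn hG.isOpen (hG.contDiffOn_localGrad hF k) hy
  have hdF (l : Fin d) :=
    differentiableAt_of_contDiffOn hG.isOpen (contDiffOn_pderiv hG.isOpen hF l) hy
  unfold christoffelDiff conformalTensor
  refine ((hG.differentiableAt hy i j).mul hgrad).sub (.add ?_ ?_) <;> split_ifs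
  exacts [hdF i, differentiableAt_const _, hdF j, differentiableAt_const _]

theorem covDerivTensor_christoffelDiff (hG : IsLocalMetricOn G U) (hF : ContDiffOn ℝ ∞ F U)
    (hy : y ∈ U) (m k i j : Fin d) :
    covDerivTensor G (christoffelDiff G F) m k i j y =
      conformalTensor (G y) (covDeriv G (localGrad G F) m · y) (localHessian G F m · y) k i j :=
  hG.covDerivTensor_conformalTensor
    (fun k ↦ differentiableAt_of_contDiffOn hG.isOpen (hG.contDiffOn_localGrad hF k) hy)
    (fun i ↦ differentiableAt_of_contDiffOn hG.isOpen (contDiffOn_pderiv hG.isOpen hF i) hy)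
    hy m k i j

theorem ricci_expScale (hG : IsLocalMetricOn G U) (hF : ContDiffOn ℝ ∞ F U) (hy : y ∈ U)
    (i j : Fin d) :
    ricci (expScale G F) i j y = ricci G i j y +
      (d - 2) * (localHessian G F i j y + pderiv i F y * pderiv j F y) +
      G y i j * (localLaplacian G F y - (d - 2) * localGradInner G F F y) := by
  have divergence : ∑ k, covDerivTensor G (christoffelDiff G F) k k i j y =
      G y i j * localLaplacian G F y - 2 * localHessian G F i j y := by
    simp only [hG.covDerivTensor_christoffelDiff hF hy, conformalTensor, Finset.sum_sub_distrib,
      Finset.sum_add_distrib, ← Finset.mul_sum, hG.sum_covDeriv_localGrad hF hy,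
      Finset.sum_ite_eq', Finset.mem_univ, if_true, hG.localHessian_symm hF hy j i]
    ring
  have trace : ∑ k, covDerivTensor G (christoffelDiff G F) j k i k y =
      -d * localHessian G F i j y := by
    simp only [hG.covDerivTensor_christoffelDiff hF hy,
      trace_conformalTensor fun i ↦ hG.sum_mul_covDeriv_localGrad hF hy j i,
      hG.localHessian_symm hF hy j i, Fintype.card_fin]
  have quadratic := sum_conformalTensor_mul_sub (hG.isSymm y hy)
    (hG.sum_mul_localGrad (F := F) hy) i j
  rw [ricci_of_christoffel_eq_add (A := christoffelDiff G F) hG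
    (hG.differentiableAt_christoffelDiff hF hy)
    (fun k i j ↦ conformalTensor_symm (hG.isSymm y hy) k i j)
    (fun k i j z hz ↦
      hG.christoffel_expScale (differentiableAt_of_contDiffOn hG.isOpen hF hz) hz k i j) hy,
    Finset.sum_sub_distrib, divergence, trace]
  unfold christoffelDiff
  rw [quadratic, ← localGradInner_eq_sum_localGrad, Fintype.card_fin]
  ring

theorem localGradInner_expScale (hG : IsLocalMetricOn G U) (hy : y ∈ U) {H K : E[d] → ℝ} :
    localGradInner (expScale G F) H K y = Real.exp (2 * F y) * localGradInner G H K y := by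
  simp only [localGradInner, hG.expScale_inv hy, Matrix.smul_apply, smul_eq_mul, Finset.mul_sum,
    mul_assoc]

theorem localScalarCurvature_expScale (hG : IsLocalMetricOn G U) (hF : ContDiffOn ℝ ∞ F U)
    (hy : y ∈ U) :
    localScalarCurvature (expScale G F) y = Real.exp (2 * F y) * (localScalarCurvature G y +
      2 * (d - 1) * localLaplacian G F y - (d - 1) * (d - 2) * localGradInner G F F y) := by
  have contract (a b : ℝ) : ∑ i, ∑ j, (G y)⁻¹ i j * (ricci G i j y +
      a * (localHessian G F i j y + pderiv i F y * pderiv j F y) + G y i j * b) =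
      localScalarCurvature G y + a * (localLaplacian G F y + localGradInner G F F y) + d * b := by
    simp only [mul_add, Finset.sum_add_distrib, ← mul_assoc, ← Finset.sum_mul,
      hG.sum_inv_mul_self hy]
    simp only [mul_comm _ a, mul_assoc, ← Finset.mul_sum]
    rfl
  rw [localScalarCurvature]
  simp only [hG.expScale_inv hy, Matrix.smul_apply, smul_eq_mul, mul_assoc (Real.exp _),
    ← Finset.mul_sum, hG.ricci_expScale hF hy, contract]
  ring

theorem localLaplacian_expScale (hG : IsLocalMetricOn G U) (hF : DifferentiableAt ℝ F y)
    (hy : y ∈ U) :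
    localLaplacian (expScale G F) H y =
      Real.exp (2 * F y) * (localLaplacian G H y - (d - 2) * localGradInner G F H y) := by
  have hhess (i j : Fin d) : localHessian (expScale G F) H i j y = localHessian G H i j y -
      (G y i j * localGradInner G F H y -
        (pderiv i F y * pderiv j H y + pderiv j F y * pderiv i H y)) := by
    have := sum_mul_conformalTensor (g := G y) (v := (localGrad G F · y)) (w := (pderiv · F y))
      (pderiv · H y) i j
    rw [← localGradInner_eq_sum_localGrad, hG.localGradInner_comm hy] at this
    simp only [localHessian, covDerivForm, hG.christoffel_expScale hF hy, add_mul,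
      Finset.sum_add_distrib, christoffelDiff, mul_comm (conformalTensor _ _ _ _ _ _), this]
    ring
  have hswap : ∑ i, ∑ j, (G y)⁻¹ i j * (pderiv j F y * pderiv i H y) = localGradInner G F H y := by
    rw [hG.localGradInner_comm hy, localGradInner]
    simp only [mul_comm (pderiv _ H y)]
  have contract (b : ℝ) : ∑ i, ∑ j, (G y)⁻¹ i j * (localHessian G H i j y - (G y i j * b -
      (pderiv i F y * pderiv j H y + pderiv j F y * pderiv i H y))) =
      localLaplacian G H y - (d * b - (localGradInner G F H y + localGradInner G F H y)) := by
    nth_rw 2 [← hswap]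
    simp only [mul_sub, mul_add, Finset.sum_sub_distrib, Finset.sum_add_distrib]
    simp only [← mul_assoc, ← Finset.sum_mul, hG.sum_inv_mul_self hy]
    simp only [mul_assoc]
    rfl
  simp only [localLaplacian_eq_sum_localHessian, hhess, hG.expScale_inv hy, Matrix.smul_apply,
    smul_eq_mul, mul_assoc (Real.exp _), ← Finset.mul_sum]
  rw [contract, ← localLaplacian_eq_sum_localHessian]
  ring

end IsLocalMetricOn

end ConformalChange

section ManifoldMetric

variable {d : ℕ} {M : Type*} [TopologicalSpace M] [ChartedSpace E[d] M] [IsManifold (𝓡 d) ∞ M]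

theorem contDiffOn_inChart (f : SmoothFun d M) (x : M) :
    ContDiffOn ℝ ∞ (inChart x f) (chartAt E[d] x).target :=
  contMDiffOn_iff_contDiffOn.1 <|
    f.contMDiff.comp_contMDiffOn (contMDiffOn_chart_symm (I := 𝓡 d) (x := x))

/-- The differential at `y` of the inverse of the preferred chart at `x`, as a linear map on
`ℝᵈ`. -/
noncomputable def chartSymmDeriv (x : M) (y : E[d]) :
    E[d] →L[ℝ] TangentSpace (𝓡 d) ((chartAt E[d] x).symm y) :=
  mfderiv 𝓘(ℝ, E[d]) (𝓡 d) (chartAt E[d] x).symm y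

theorem metricInChart_apply (g : SmoothMetric d M) (x : M) (y : E[d]) (i j : Fin d) :
    metricInChart g x y i j =
      g.inner ((chartAt E[d] x).symm y) (chartSymmDeriv x y (EuclideanSpace.single i 1))
        (chartSymmDeriv x y (EuclideanSpace.single j 1)) :=
  rfl

theorem inner_chartSymmDeriv (g : SmoothMetric d M) (x : M) (y u v : E[d]) :
    g.inner ((chartAt E[d] x).symm y) (chartSymmDeriv x y u) (chartSymmDeriv x y v) =
      u ⬝ᵥ (metricInChart g x y).mulVec v := by
  have hsum (w : E[d]) : chartSymmDeriv x y w =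
      ∑ i, w i • chartSymmDeriv x y (EuclideanSpace.single i 1) := by
    conv_lhs => rw [← (EuclideanSpace.basisFun (Fin d) ℝ).sum_repr w]
    simp
  rw [hsum u, hsum v]
  simp only [map_sum, map_smul, sum_apply, smul_apply, smul_eq_mul, dotProduct, Matrix.mulVec,
    metricInChart_apply, Finset.mul_sum]
  rw [Finset.sum_comm]
  exact Finset.sum_congr rfl fun i _ ↦ Finset.sum_congr rfl fun j _ ↦ by ring

theorem chartSymmDeriv_injective (x : M) {y : E[d]} (hy : y ∈ (chartAt E[d] x).target) :
    Function.Injective (chartSymmDeriv x y) :=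
  (mdifferentiable_chart (I := 𝓡 d) x).symm.mfderiv_injective hy

theorem isSymm_metricInChart (g : SmoothMetric d M) (x : M) (y : E[d]) :
    (metricInChart g x y).IsSymm :=
  Matrix.IsSymm.ext fun _ _ ↦ g.symm _ _ _

theorem posDef_metricInChart (g : SmoothMetric d M) (x : M) {y : E[d]}
    (hy : y ∈ (chartAt E[d] x).target) : (metricInChart g x y).PosDef := by
  refine Matrix.PosDef.of_dotProduct_mulVec_pos (isSymm_metricInChart g x y) fun v hv ↦ ?_
  rw [star_trivial, ← inner_chartSymmDeriv g x y (WithLp.toLp 2 v) (WithLp.toLp 2 v)]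
  exact g.pos _ _ ((map_ne_zero_iff _ (chartSymmDeriv_injective x hy)).2 (by simpa using hv))

theorem contMDiffOn_chartSymmDeriv (x : M) (v : E[d]) :
    ContMDiffOn 𝓘(ℝ, E[d]) (𝓡 d).tangent ∞
      (fun y ↦ (⟨(chartAt E[d] x).symm y, chartSymmDeriv x y v⟩ : TangentBundle (𝓡 d) M))
      (chartAt E[d] x).target := by
  set φ := chartAt E[d] x
  have hφ : ContMDiffOn 𝓘(ℝ, E[d]) (𝓡 d) ∞ φ.symm φ.target := contMDiffOn_chart_symm
  have htangent := hφ.contMDiffOn_tangentMapWithin (m := ∞) le_rfl φ.open_target.uniqueMDiffOn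
  have hv := (contMDiffOn_vectorSpace_iff_contDiffOn (𝕜 := ℝ) (n := ∞) (s := φ.target)
    (V := fun _ : E[d] ↦ v)).2 contDiffOn_const
  refine (htangent.comp hv fun y hy ↦ hy).congr fun y hy ↦ ?_
  simp only [Function.comp, tangentMapWithin, mfderivWithin_of_isOpen φ.open_target hy]
  rfl

theorem contDiffOn_metricInChart (g : SmoothMetric d M) (x : M) (i j : Fin d) :
    ContDiffOn ℝ ∞ (fun y ↦ metricInChart g x y i j) (chartAt E[d] x).target := by
  set φ := chartAt E[d] x
  have hsection : ContMDiffOn 𝓘(ℝ, E[d]) ((𝓡 d).prod 𝓘(ℝ, ℝ)) ∞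
      (fun y ↦ Bundle.TotalSpace.mk' ℝ (E := Bundle.Trivial M ℝ) (φ.symm y)
        (metricInChart g x y i j)) φ.target := by
    refine ContMDiffOn.clm_bundle_apply₂ (F₁ := E[d]) (F₂ := E[d])
      ?_ (contMDiffOn_chartSymmDeriv x _) (contMDiffOn_chartSymmDeriv x _)
    exact g.contMDiff.comp_contMDiffOn contMDiffOn_chart_symm
  rw [← contMDiffOn_iff_contDiffOn]
  exact fun y hy ↦ (Bundle.contMDiffWithinAt_totalSpace.1 (hsection y hy)).2

theorem isLocalMetricOn_metricInChart (g : SmoothMetric d M) (x : M) :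
    IsLocalMetricOn (metricInChart g x) (chartAt E[d] x).target where
  isOpen := (chartAt E[d] x).open_target
  contDiffOn := contDiffOn_metricInChart g x
  isSymm y _ := isSymm_metricInChart g x y
  isUnit_det _ hy := (posDef_metricInChart g x hy).det_pos.ne'.isUnit

end ManifoldMetric

section ConformalMetric

variable {d : ℕ} {M : Type*} [TopologicalSpace M] [ChartedSpace E[d] M] [IsManifold (𝓡 d) ∞ M]

/-- The metric `e^{-2τ} g`. -/
noncomputable def conformalMetric (g : SmoothMetric d M) (τ : SmoothFun d M) :
    SmoothMetric d M where
  inner x := Real.exp (-2 * τ x) • g.inner x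
  symm x v w := by simp [g.symm x v w]
  pos x v hv := by
    have := g.pos x v hv
    simp only [smul_apply, smul_eq_mul]
    positivity
  isVonNBounded x := by
    have hball := (g.isVonNBounded x).image
      (Real.exp (τ x) • ContinuousLinearMap.id ℝ (TangentSpace (𝓡 d) x))
    refine hball.subset fun v (hv : Real.exp (-2 * τ x) * g.inner x v v < 1) ↦ ?_
    refine ⟨Real.exp (-τ x) • v, ?_, by simp [smul_smul, ← Real.exp_add]⟩
    have hexp : Real.exp (-2 * τ x) = Real.exp (-τ x) * Real.exp (-τ x) := by
      rw [← Real.exp_add]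
      ring_nf
    rw [hexp, mul_assoc] at hv
    simpa using hv
  contMDiff := by
    have hfactor : ContMDiff (𝓡 d) 𝓘(ℝ, ℝ) ∞ fun x ↦ Real.exp (-2 * τ x) :=
      Real.contDiff_exp.contMDiff.comp (contMDiff_const.mul τ.contMDiff)
    exact hfactor.smul_section g.contMDiff

theorem metricInChart_conformalMetric (g : SmoothMetric d M) (τ : SmoothFun d M) (x : M) :
    metricInChart (conformalMetric g τ) x = expScale (metricInChart g x) (inChart x τ) :=
  rfl

theorem gradInner_conformalMetric (g : SmoothMetric d M) (τ : SmoothFun d M) (f h : M → ℝ) (x : M) :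
    gradInner (conformalMetric g τ) f h x = Real.exp (2 * τ x) * gradInner g f h x := by
  rw [gradInner, metricInChart_conformalMetric,
    (isLocalMetricOn_metricInChart g x).localGradInner_expScale (mem_chart_target _ x)]
  simp [gradInner, inChart]

theorem laplacian_conformalMetric (g : SmoothMetric d M) (τ : SmoothFun d M) (f : M → ℝ) (x : M) :
    laplacian (conformalMetric g τ) f x =
      Real.exp (2 * τ x) * (laplacian g f x - (d - 2) * gradInner g τ f x) := by
  rw [laplacian, metricInChart_conformalMetric,
    (isLocalMetricOn_metricInChart g x).localLaplacian_expScale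
      (differentiableAt_of_contDiffOn (chartAt _ x).open_target (contDiffOn_inChart τ x)
        (mem_chart_target _ x)) (mem_chart_target _ x)]
  simp [gradInner, laplacian, inChart]

theorem scalarCurvature_conformalMetric (g : SmoothMetric d M) (τ : SmoothFun d M) (x : M) :
    scalarCurvature (conformalMetric g τ) x = Real.exp (2 * τ x) * (scalarCurvature g x +
      2 * (d - 1) * laplacian g τ x - (d - 1) * (d - 2) * gradInner g τ τ x) := by
  rw [scalarCurvature, metricInChart_conformalMetric,
    (isLocalMetricOn_metricInChart g x).localScalarCurvature_expScale
      (contDiffOn_inChart τ x) (mem_chart_target _ x)]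
  simp [gradInner, laplacian, inChart, scalarCurvature]

end ConformalMetric

section WithDensity

variable {α β : Type*} [MeasurableSpace α] [MeasurableSpace β]

theorem withDensity_mono_left {μ ν : Measure α} (h : μ ≤ ν) (f : α → ENNReal) :
    μ.withDensity f ≤ ν.withDensity f := by
  refine Measure.le_iff.2 fun s hs ↦ ?_
  rw [withDensity_apply _ hs, withDensity_apply _ hs]
  exact lintegral_mono' (Measure.restrict_mono le_rfl h) le_rfl

theorem withDensity_iSup {ι : Type*} (μ : ι → Measure α) {f : α → ENNReal} (hf : Measurable f)
    (hzero : ∀ x, f x ≠ 0) (htop : ∀ x, f x ≠ ⊤) :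
    (⨆ i, μ i).withDensity f = ⨆ i, (μ i).withDensity f := by
  refine le_antisymm ?_ (iSup_le fun i ↦ withDensity_mono_left (le_iSup μ i) f)
  -- `ν ↦ ν.withDensity f` is an order isomorphism, with inverse `ν ↦ ν.withDensity f⁻¹`.
  have hinv : ⨆ i, μ i ≤ (⨆ i, (μ i).withDensity f).withDensity f⁻¹ := by
    refine iSup_le fun i ↦ ?_
    calc μ i = ((μ i).withDensity f).withDensity f⁻¹ :=
          (withDensity_inv_same hf (.of_forall hzero) (.of_forall htop)).symm
      _ ≤ _ := withDensity_mono_left (le_iSup (fun i ↦ (μ i).withDensity f) i) _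
  have hcancel := withDensity_inv_same (μ := ⨆ i, (μ i).withDensity f) hf.inv
    (.of_forall fun x ↦ ENNReal.inv_ne_zero.2 (htop x))
    (.of_forall fun x ↦ ENNReal.inv_ne_top.2 (hzero x))
  simp only [Pi.inv_apply, inv_inv] at hcancel
  exact (withDensity_mono_left hinv f).trans_eq hcancel

theorem withDensity_map {μ : Measure α} {φ : α → β} (hφ : AEMeasurable φ μ) {f : β → ENNReal}
    (hf : Measurable f) :
    (μ.map φ).withDensity f = (μ.withDensity (f ∘ φ)).map φ := by
  ext s hs
  have hpre := hφ.nullMeasurableSet_preimage hs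
  rw [withDensity_apply _ hs, ← lintegral_indicator hs,
    lintegral_map' (hf.indicator hs).aemeasurable hφ,
    Measure.map_apply_of_aemeasurable (hφ.mono_ac (withDensity_absolutelyContinuous _ _)) hs,
    withDensity_apply₀ _ hpre, ← lintegral_indicator₀ hpre]
  rfl

theorem eq_of_withDensity_eq_of_continuous [TopologicalSpace α] [OpensMeasurableSpace α]
    {μ : Measure α} [IsLocallyFiniteMeasure μ] [μ.IsOpenPosMeasure] {f g : α → ENNReal}
    (hf : Continuous f) (hg : Continuous g) (h : μ.withDensity f = μ.withDensity g) : f = g := by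
  ext x
  obtain ⟨U, hxU, hU, hμU⟩ := μ.exists_isOpen_measure_lt_top x
  have : IsFiniteMeasure (μ.restrict U) := isFiniteMeasure_restrict.2 hμU.ne
  have hae : f =ᵐ[μ.restrict U] g := by
    rw [← withDensity_eq_iff_of_sigmaFinite hf.aemeasurable hg.aemeasurable,
      ← restrict_withDensity hU.measurableSet, ← restrict_withDensity hU.measurableSet, h]
  exact Measure.eqOn_open_of_ae_eq hae hU hf.continuousOn hg.continuousOn hxU

end WithDensity

section ChartDensity

variable {d : ℕ} {M : Type*} [TopologicalSpace M] [ChartedSpace E[d] M] [IsManifold (𝓡 d) ∞ M]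

/-- The density `√(det G)` of the Riemannian volume in the preferred chart at `x`. -/
noncomputable def chartDensity (g : SmoothMetric d M) (x : M) (y : E[d]) : ENNReal :=
  ENNReal.ofReal (Real.sqrt (metricInChart g x y).det)

theorem continuousOn_chartDensity (g : SmoothMetric d M) (x : M) :
    ContinuousOn (chartDensity g x) (chartAt E[d] x).target :=
  ENNReal.continuous_ofReal.comp_continuousOn
    (contDiffOn_det (contDiffOn_metricInChart g x)).continuousOn.sqrt

theorem aemeasurable_chartDensity (g : SmoothMetric d M) (x : M) :
    AEMeasurable (chartDensity g x) (volume.restrict (chartAt E[d] x).target) :=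
  (continuousOn_chartDensity g x).aemeasurable (chartAt E[d] x).open_target.measurableSet

theorem chartDensity_pos (g : SmoothMetric d M) (x : M) {y : E[d]}
    (hy : y ∈ (chartAt E[d] x).target) : 0 < chartDensity g x y :=
  ENNReal.ofReal_pos.2 (Real.sqrt_pos.2 (posDef_metricInChart g x hy).det_pos)

theorem finiteAtFilter_withDensity_chartDensity (g : SmoothMetric d M) (x : M) {y : E[d]}
    (hy : y ∈ (chartAt E[d] x).target) :
    (volume.withDensity (chartDensity g x)).FiniteAtFilter (nhds y) := by
  have hlt : ∀ᶠ z in nhds y, chartDensity g x z < chartDensity g x y + 1 :=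
    ((continuousOn_chartDensity g x).continuousAt
      ((chartAt E[d] x).open_target.mem_nhds hy)).eventually
      (Iio_mem_nhds (ENNReal.lt_add_right ENNReal.ofReal_ne_top one_ne_zero))
  obtain ⟨r, hr, hball⟩ := Metric.eventually_nhds_iff_ball.1 hlt
  refine ⟨Metric.ball y r, Metric.ball_mem_nhds y hr, ?_⟩
  calc volume.withDensity (chartDensity g x) (Metric.ball y r)
      = ∫⁻ z in Metric.ball y r, chartDensity g x z :=
        withDensity_apply _ Metric.isOpen_ball.measurableSet
    _ ≤ ∫⁻ _ in Metric.ball y r, (chartDensity g x y + 1) :=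
        setLIntegral_mono' Metric.isOpen_ball.measurableSet fun z hz ↦ (hball z hz).le
    _ < ⊤ := by
        rw [setLIntegral_const]
        exact ENNReal.mul_lt_top (ENNReal.add_lt_top.2 ⟨ENNReal.ofReal_lt_top,
          ENNReal.one_lt_top⟩) measure_ball_lt_top

theorem chartDensity_conformalMetric (g : SmoothMetric d M) (τ : SmoothFun d M) (x : M)
    (y : E[d]) :
    chartDensity (conformalMetric g τ) x y =
      chartDensity g x y * ENNReal.ofReal (Real.exp (-d * τ ((chartAt E[d] x).symm y))) := by
  have hsqrt : Real.sqrt (Real.exp (-2 * inChart x τ y) ^ d) =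
      Real.exp (-d * τ ((chartAt E[d] x).symm y)) := by
    rw [Real.sqrt_eq_iff_mul_self_eq (by positivity) (by positivity), ← Real.exp_add,
      ← Real.exp_nat_mul, inChart]
    ring_nf
  rw [chartDensity, metricInChart_conformalMetric, expScale, Matrix.det_smul, Fintype.card_fin,
    Real.sqrt_mul (by positivity), hsqrt, mul_comm, ENNReal.ofReal_mul (Real.sqrt_nonneg _),
    chartDensity]

end ChartDensity

section Transition

variable {d : ℕ} {M : Type*} [TopologicalSpace M] [ChartedSpace E[d] M]

/-- The change of coordinates from the preferred chart at `y` to the one at `x`. -/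
noncomputable def transition (x y : M) (z : E[d]) : E[d] :=
  chartAt E[d] x ((chartAt E[d] y).symm z)

theorem injOn_transition (x y : M) :
    Set.InjOn (transition x y)
      ((chartAt E[d] y).symm ⁻¹' (chartAt E[d] x).source ∩ (chartAt E[d] y).target) :=
  fun _ hz _ hw h ↦ (chartAt E[d] y).symm.injOn hz.2 hw.2 ((chartAt E[d] x).injOn hz.1 hw.1 h)

variable [IsManifold (𝓡 d) ∞ M]

theorem differentiableAt_transition {x y : M} {z : E[d]}
    (hz : z ∈ (chartAt E[d] y).target)
    (hx : (chartAt E[d] y).symm z ∈ (chartAt E[d] x).source) :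
    DifferentiableAt ℝ (transition x y) z := by
  rw [← mdifferentiableAt_iff_differentiableAt]
  exact ((mdifferentiable_chart (I := 𝓡 d) x).mdifferentiableAt hx).comp z
    ((mdifferentiable_chart (I := 𝓡 d) y).mdifferentiableAt_symm hz)

theorem chartSymmDeriv_transition {x y : M} {z : E[d]}
    (hz : z ∈ (chartAt E[d] y).target)
    (hx : (chartAt E[d] y).symm z ∈ (chartAt E[d] x).source) (v : E[d]) :
    (chartSymmDeriv y z v : E[d]) =
      (chartSymmDeriv x (transition x y z) (fderiv ℝ (transition x y) z v) : E[d]) := by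
  have heq : (chartAt E[d] y).symm =ᶠ[nhds z] (chartAt E[d] x).symm ∘ transition x y := by
    filter_upwards [((chartAt E[d] y).continuousAt_symm hz).eventually
      ((chartAt E[d] x).open_source.mem_nhds hx)] with w hw
    exact ((chartAt E[d] x).left_inv hw).symm
  have hchain := mfderiv_comp (I := 𝓘(ℝ, E[d])) (I' := 𝓘(ℝ, E[d])) (I'' := 𝓡 d) z
    ((mdifferentiable_chart (I := 𝓡 d) x).mdifferentiableAt_symm
      ((chartAt E[d] x).map_source hx))
    (differentiableAt_transition hz hx).mdifferentiableAt
  rw [mfderiv_eq_fderiv] at hchain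
  exact congrArg (fun L : E[d] →L[ℝ] E[d] ↦ L v)
    ((heq.mfderiv_eq (I := 𝓘(ℝ, E[d])) (I' := 𝓡 d)).trans hchain)

theorem inner_congr_basePoint (g : SmoothMetric d M) {p q : M} (h : p = q) (v w : E[d]) :
    (g.inner p v w : ℝ) = g.inner q v w := by
  rw [h]

theorem metricInChart_transition (g : SmoothMetric d M) {x y : M} {z : E[d]}
    (hz : z ∈ (chartAt E[d] y).target)
    (hx : (chartAt E[d] y).symm z ∈ (chartAt E[d] x).source) (i j : Fin d) :
    metricInChart g y z i j =
      fderiv ℝ (transition x y) z (EuclideanSpace.single i 1) ⬝ᵥ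
        (metricInChart g x (transition x y z)).mulVec
          (fderiv ℝ (transition x y) z (EuclideanSpace.single j 1)) := by
  rw [← inner_chartSymmDeriv, metricInChart_apply]
  refine Eq.trans ?_ (inner_congr_basePoint g ((chartAt E[d] x).left_inv hx) _ _).symm
  exact congrArg₂ (fun v w : E[d] ↦ (g.inner ((chartAt E[d] y).symm z) v w : ℝ))
    (chartSymmDeriv_transition hz hx _) (chartSymmDeriv_transition hz hx _)

theorem det_metricInChart_transition (g : SmoothMetric d M) {x y : M} {z : E[d]}
    (hz : z ∈ (chartAt E[d] y).target)
    (hx : (chartAt E[d] y).symm z ∈ (chartAt E[d] x).source) :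
    (metricInChart g y z).det =
      (fderiv ℝ (transition x y) z).det ^ 2 * (metricInChart g x (transition x y z)).det := by
  set b := (EuclideanSpace.basisFun (Fin d) ℝ).toBasis
  set J := LinearMap.toMatrix b b (fderiv ℝ (transition x y) z).toLinearMap with hJ
  have hdet : (fderiv ℝ (transition x y) z).det = J.det := (LinearMap.det_toMatrix b _).symm
  have hG : metricInChart g y z =
      J.transpose * (metricInChart g x (transition x y z) * J) := by
    ext i j
    rw [metricInChart_transition g hz hx, Matrix.mul_apply]
    simp [dotProduct, Matrix.mulVec, Matrix.mul_apply, hJ, LinearMap.toMatrix_apply, b]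
  rw [hG, Matrix.det_mul, Matrix.det_mul, Matrix.det_transpose, hdet]
  ring

theorem chartDensity_transition (g : SmoothMetric d M) {x y : M} {z : E[d]}
    (hz : z ∈ (chartAt E[d] y).target)
    (hx : (chartAt E[d] y).symm z ∈ (chartAt E[d] x).source) :
    chartDensity g y z = ENNReal.ofReal |(fderiv ℝ (transition x y) z).det| *
      chartDensity g x (transition x y z) := by
  rw [chartDensity, chartDensity, det_metricInChart_transition g hz hx,
    Real.sqrt_mul (sq_nonneg _), Real.sqrt_sq_eq_abs, ENNReal.ofReal_mul (abs_nonneg _)]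

end Transition

section Volume

variable {d : ℕ} {M : Type*} [TopologicalSpace M] [ChartedSpace E[d] M]
  [MeasurableSpace M] [BorelSpace M]

theorem aemeasurable_chart_symm (x : M) :
    AEMeasurable (chartAt E[d] x).symm (volume.restrict (chartAt E[d] x).target) :=
  (chartAt E[d] x).continuousOn_symm.aemeasurable (chartAt E[d] x).open_target.measurableSet

theorem measurableSet_chart_symm_preimage (x : M) {A : Set M} (hA : MeasurableSet A) :
    MeasurableSet ((chartAt E[d] x).symm ⁻¹' A ∩ (chartAt E[d] x).target) := by
  have hmeas : Measurable ((chartAt E[d] x).target.domRestrict (chartAt E[d] x).symm) :=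
    (continuousOn_iff_continuous_domRestrict.1 (chartAt E[d] x).continuousOn_symm).measurable
  convert (chartAt E[d] x).open_target.measurableSet.subtype_image (hmeas hA) using 1
  ext z
  simp [Set.domRestrict, and_comm]

theorem measurable_ofReal_exp_mul (τ : SmoothFun d M) (a : ℝ) :
    Measurable fun p ↦ ENNReal.ofReal (Real.exp (a * τ p)) := by
  have hτ : Continuous τ := τ.contMDiff.continuous
  fun_prop

variable [IsManifold (𝓡 d) ∞ M]

theorem chartVolume_apply (g : SmoothMetric d M) (x : M) {A : Set M} (hA : MeasurableSet A) :
    chartVolume g x A =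
      ∫⁻ y in (chartAt E[d] x).symm ⁻¹' A ∩ (chartAt E[d] x).target, chartDensity g x y := by
  rw [chartVolume, Measure.map_apply_of_aemeasurable ((aemeasurable_chart_symm x).mono_ac
    (withDensity_absolutelyContinuous _ _)) hA, withDensity_apply',
    Measure.restrict_restrict' (chartAt E[d] x).open_target.measurableSet]
  rfl

theorem chartVolume_conformalMetric (g : SmoothMetric d M) (τ : SmoothFun d M) (x : M) :
    chartVolume (conformalMetric g τ) x =
      (chartVolume g x).withDensity fun p ↦ ENNReal.ofReal (Real.exp (-d * τ p)) := by
  have hf := measurable_ofReal_exp_mul τ (-d)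
  have hφ := aemeasurable_chart_symm (d := d) x
  simp only [chartVolume]
  rw [withDensity_map (hφ.mono_ac (withDensity_absolutelyContinuous _ _)) hf]
  congr 1
  refine Eq.trans ?_
    (withDensity_mul₀ (aemeasurable_chartDensity g x) (hf.comp_aemeasurable hφ))
  exact congrArg _ (funext fun y ↦ chartDensity_conformalMetric g τ x y)

theorem riemannianVolume_conformalMetric (g : SmoothMetric d M) (τ : SmoothFun d M) :
    riemannianVolume (conformalMetric g τ) =
      (riemannianVolume g).withDensity fun p ↦ ENNReal.ofReal (Real.exp (-d * τ p)) := by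
  simp only [riemannianVolume, chartVolume_conformalMetric]
  exact (withDensity_iSup _ (measurable_ofReal_exp_mul τ (-d))
    (fun p ↦ (ENNReal.ofReal_pos.2 (Real.exp_pos _)).ne') fun p ↦ ENNReal.ofReal_ne_top).symm

theorem chartVolume_restrict_source_le (g : SmoothMetric d M) (x y : M) :
    (chartVolume g y).restrict (chartAt E[d] x).source ≤ chartVolume g x := by
  refine Measure.le_iff.2 fun A hA ↦ ?_
  have hA' := hA.inter (chartAt E[d] x).open_source.measurableSet
  rw [Measure.restrict_apply hA, chartVolume_apply g y hA', chartVolume_apply g x hA]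
  set B := (chartAt E[d] y).symm ⁻¹' (A ∩ (chartAt E[d] x).source) ∩ (chartAt E[d] y).target
  have hB : MeasurableSet B := measurableSet_chart_symm_preimage y hA'
  have hinj : Set.InjOn (transition x y) B :=
    (injOn_transition x y).mono (Set.inter_subset_inter_left _ fun _ hz ↦ hz.2)
  calc ∫⁻ z in B, chartDensity g y z
      = ∫⁻ z in B, ENNReal.ofReal |(fderiv ℝ (transition x y) z).det| *
          chartDensity g x (transition x y z) :=
        setLIntegral_congr_fun hB fun z hz ↦ chartDensity_transition g hz.2 hz.1.2
    _ = ∫⁻ z in transition x y '' B, chartDensity g x z :=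
        (lintegral_image_eq_lintegral_abs_det_fderiv_mul volume hB (fun z hz ↦
          (differentiableAt_transition hz.2 hz.1.2).hasFDerivAt.hasFDerivWithinAt) hinj _).symm
    _ ≤ _ := by
        refine lintegral_mono_set ?_
        rintro _ ⟨z, hz, rfl⟩
        refine ⟨?_, (chartAt E[d] x).map_source hz.1.2⟩
        rw [Set.mem_preimage, transition, (chartAt E[d] x).left_inv hz.1.2]
        exact hz.1.1

theorem riemannianVolume_restrict_source_le (g : SmoothMetric d M) (x : M) :
    (riemannianVolume g).restrict (chartAt E[d] x).source ≤ chartVolume g x := by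
  have hS := (chartAt E[d] x).open_source.measurableSet
  have hle : riemannianVolume g ≤
      chartVolume g x + (riemannianVolume g).restrict (chartAt E[d] x).sourceᶜ := by
    refine iSup_le fun y ↦ ?_
    rw [← Measure.restrict_add_restrict_compl (μ := chartVolume g y) hS]
    exact add_le_add (chartVolume_restrict_source_le g x y)
      (Measure.restrict_mono le_rfl (le_iSup (chartVolume g) y))
  calc (riemannianVolume g).restrict (chartAt E[d] x).source
      ≤ (chartVolume g x + (riemannianVolume g).restrict (chartAt E[d] x).sourceᶜ).restrict
          (chartAt E[d] x).source := Measure.restrict_mono le_rfl hle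
    _ = (chartVolume g x).restrict (chartAt E[d] x).source := by
        simp [Measure.restrict_restrict hS]
    _ ≤ chartVolume g x := Measure.restrict_le_self

theorem finiteAtFilter_chartVolume (g : SmoothMetric d M) (x : M) :
    (chartVolume g x).FiniteAtFilter (nhds x) := by
  set φ := chartAt E[d] x
  obtain ⟨V, hV, hfin⟩ := finiteAtFilter_withDensity_chartDensity g x (mem_chart_target E[d] x)
  obtain ⟨U, hUV, hU, hxU⟩ := mem_nhds_iff.1 hV
  have hopen : IsOpen (φ.source ∩ φ ⁻¹' U) := φ.isOpen_inter_preimage hU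
  refine ⟨_, hopen.mem_nhds ⟨mem_chart_source _ x, hxU⟩, ?_⟩
  have hsub : φ.symm ⁻¹' (φ.source ∩ φ ⁻¹' U) ∩ φ.target ⊆ U := fun z hz ↦ by
    simpa [φ.right_inv hz.2] using hz.1.2
  calc chartVolume g x (φ.source ∩ φ ⁻¹' U)
      ≤ ∫⁻ z in U, chartDensity g x z :=
        (chartVolume_apply g x hopen.measurableSet).trans_le (lintegral_mono_set hsub)
    _ = volume.withDensity (chartDensity g x) U := (withDensity_apply _ hU.measurableSet).symm
    _ < ⊤ := (measure_mono hUV).trans_lt hfin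

instance isLocallyFiniteMeasure_riemannianVolume (g : SmoothMetric d M) :
    IsLocallyFiniteMeasure (riemannianVolume g) where
  finiteAtNhds x := by
    obtain ⟨s, hs, hfin⟩ := finiteAtFilter_chartVolume g x
    refine ⟨s ∩ (chartAt E[d] x).source,
      Filter.inter_mem hs (chart_source_mem_nhds E[d] x), ?_⟩
    rw [← Measure.restrict_apply' (chartAt E[d] x).open_source.measurableSet]
    exact (riemannianVolume_restrict_source_le g x s).trans_lt hfin

instance isOpenPosMeasure_riemannianVolume (g : SmoothMetric d M) :
    (riemannianVolume g).IsOpenPosMeasure where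
  open_pos U hU := by
    rintro ⟨x, hx⟩ hzero
    set V := (chartAt E[d] x).symm ⁻¹' U ∩ (chartAt E[d] x).target
    have hV : IsOpen V := by
      rw [show V = _ from Set.inter_comm _ _]
      exact (chartAt E[d] x).isOpen_inter_preimage_symm hU
    have hxV : chartAt E[d] x x ∈ V :=
      ⟨by simpa using hx, mem_chart_target _ x⟩
    have hchart : ∫⁻ y in V, chartDensity g x y = 0 := by
      rw [← chartVolume_apply g x hU.measurableSet]
      exact le_antisymm ((le_iSup (chartVolume g) x U).trans_eq hzero) zero_le
    have hfalse : ∀ᵐ _ ∂volume.restrict V, False := by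
      filter_upwards [(lintegral_eq_zero_iff' ((aemeasurable_chartDensity g x).mono_set
        Set.inter_subset_right)).1 hchart, ae_restrict_mem hV.measurableSet] with y hy hyV
      exact (chartDensity_pos g x hyV.2).ne' hy
    exact hV.measure_ne_zero volume ⟨_, hxV⟩ (by simpa using hfalse)

end Volume

section Linearity

variable {d : ℕ} {G : E[d] → Matrix (Fin d) (Fin d) ℝ} {F H : E[d] → ℝ} {U : Set E[d]} {y : E[d]}

theorem pderiv_add_const_mul (hF : DifferentiableAt ℝ F y) (hH : DifferentiableAt ℝ H y) (a : ℝ)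
    (k : Fin d) : pderiv k (fun z ↦ F z + a * H z) y = pderiv k F y + a * pderiv k H y := by
  rw [pderiv_add hF (hH.const_mul a), pderiv_const_mul a hH]

theorem localGradInner_add_const_mul_right {K : E[d] → ℝ} (hF : DifferentiableAt ℝ F y)
    (hH : DifferentiableAt ℝ H y) (a : ℝ) :
    localGradInner G K (fun z ↦ F z + a * H z) y =
      localGradInner G K F y + a * localGradInner G K H y := by
  simp only [localGradInner, pderiv_add_const_mul hF hH, Finset.mul_sum,
    ← Finset.sum_add_distrib]
  exact Finset.sum_congr rfl fun i _ ↦ Finset.sum_congr rfl fun j _ ↦ by ring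

theorem localLaplacian_add_const_mul (hU : IsOpen U) (hF : ContDiffOn ℝ ∞ F U)
    (hH : ContDiffOn ℝ ∞ H U) (hy : y ∈ U) (a : ℝ) :
    localLaplacian G (fun z ↦ F z + a * H z) y =
      localLaplacian G F y + a * localLaplacian G H y := by
  have hfirst (j : Fin d) {z : E[d]} (hz : z ∈ U) :
      pderiv j (fun z ↦ F z + a * H z) z = pderiv j F z + a * pderiv j H z :=
    pderiv_add_const_mul (differentiableAt_of_contDiffOn hU hF hz)
      (differentiableAt_of_contDiffOn hU hH hz) a j
  have hsecond (i j : Fin d) : pderiv i (pderiv j fun z ↦ F z + a * H z) y =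
      pderiv i (pderiv j F) y + a * pderiv i (pderiv j H) y := by
    rw [pderiv_congr_of_eqOn hU (fun z hz ↦ hfirst j hz) hy, pderiv_add_const_mul
      (differentiableAt_of_contDiffOn hU (contDiffOn_pderiv hU hF j) hy)
      (differentiableAt_of_contDiffOn hU (contDiffOn_pderiv hU hH j) hy)]
  simp only [localLaplacian, hsecond, hfirst _ hy, Finset.mul_sum, ← Finset.sum_add_distrib]
  refine Finset.sum_congr rfl fun i _ ↦ Finset.sum_congr rfl fun j _ ↦ ?_
  simp only [mul_add, Finset.sum_add_distrib, mul_left_comm _ a, ← Finset.mul_sum]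
  ring

variable {M : Type*} [TopologicalSpace M] [ChartedSpace E[d] M] [IsManifold (𝓡 d) ∞ M]

theorem differentiableAt_inChart (f : SmoothFun d M) (x : M) :
    DifferentiableAt ℝ (inChart x f) (chartAt E[d] x x) :=
  differentiableAt_of_contDiffOn (chartAt E[d] x).open_target (contDiffOn_inChart f x)
    (mem_chart_target E[d] x)

theorem laplacian_add_const_mul (g : SmoothMetric d M) (f h : SmoothFun d M) (a : ℝ) (x : M) :
    laplacian g (fun p ↦ f p + a * h p) x = laplacian g f x + a * laplacian g h x :=
  localLaplacian_add_const_mul (chartAt E[d] x).open_target (contDiffOn_inChart f x)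
    (contDiffOn_inChart h x) (mem_chart_target E[d] x) a

theorem gradInner_comm (g : SmoothMetric d M) (f h : M → ℝ) (x : M) :
    gradInner g f h x = gradInner g h f x :=
  (isLocalMetricOn_metricInChart g x).localGradInner_comm (mem_chart_target E[d] x)

theorem gradInner_add_const_mul_right (g : SmoothMetric d M) (u : M → ℝ) (f h : SmoothFun d M)
    (a : ℝ) (x : M) :
    gradInner g u (fun p ↦ f p + a * h p) x = gradInner g u f x + a * gradInner g u h x :=
  localGradInner_add_const_mul_right (differentiableAt_inChart f x)
    (differentiableAt_inChart h x) a

theorem gradInner_add_const_mul_self (g : SmoothMetric d M) (f h : SmoothFun d M) (a : ℝ) (x : M) :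
    gradInner g (fun p ↦ f p + a * h p) (fun p ↦ f p + a * h p) x =
      gradInner g f f x + 2 * a * gradInner g f h x + a ^ 2 * gradInner g h h x := by
  rw [gradInner_add_const_mul_right, gradInner_comm g _ f, gradInner_comm g _ h,
    gradInner_add_const_mul_right, gradInner_add_const_mul_right, gradInner_comm g h f]
  ring

end Linearity

section Uniqueness

theorem eq_of_dotProduct_mulVec_self_eq {ι R : Type*} [Fintype ι] [Field R] [NeZero (2 : R)]
    {A B : Matrix ι ι R} (hA : A.IsSymm) (hB : B.IsSymm)
    (h : ∀ v : ι → R, v ⬝ᵥ A.mulVec v = v ⬝ᵥ B.mulVec v) : A = B := by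
  classical
  have isSymm_toBilin' {C : Matrix ι ι R} (hC : C.IsSymm) : (Matrix.toBilin' C).IsSymm :=
    (LinearMap.BilinForm.isSymm_iff_basis (Pi.basisFun R ι)).2 fun i j ↦ by
      simp only [Pi.basisFun_apply, Matrix.toBilin'_single, hC.apply]
  refine Matrix.toBilin'.injective (LinearMap.BilinForm.ext_of_isSymm (isSymm_toBilin' hA)
    (isSymm_toBilin' hB) fun v ↦ ?_)
  simpa only [Matrix.toBilin'_apply'] using h v

variable {d : ℕ} {M : Type*} [TopologicalSpace M] [ChartedSpace E[d] M] [IsManifold (𝓡 d) ∞ M]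

theorem exists_smoothFun_pderiv_eq [T2Space M] (x : M) (v : E[d]) :
    ∃ f : SmoothFun d M, ∀ k, pderiv k (inChart x f) (chartAt E[d] x x) = v k := by
  obtain ⟨ρ⟩ : Nonempty (SmoothBumpFunction (𝓡 d) x) := inferInstance
  let ℓ : E[d] →L[ℝ] ℝ := innerSL ℝ v
  have hℓ : ContMDiffOn (𝓡 d) 𝓘(ℝ, ℝ) ∞ (fun p ↦ ℓ (chartAt E[d] x p)) (chartAt E[d] x).source :=
    ℓ.contDiff.contMDiff.comp_contMDiffOn (contMDiffOn_chart (I := 𝓡 d) (x := x))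
  refine ⟨⟨fun p ↦ ρ p • ℓ (chartAt E[d] x p), ρ.contMDiff_smul hℓ⟩, fun k ↦ ?_⟩
  have hρ : ∀ᶠ z in nhds (chartAt E[d] x x), ρ ((chartAt E[d] x).symm z) = 1 := by
    have htendsto := (chartAt E[d] x).continuousAt_symm (mem_chart_target E[d] x)
    rw [ContinuousAt, (chartAt E[d] x).left_inv (mem_chart_source E[d] x)] at htendsto
    exact htendsto.eventually ρ.eventuallyEq_one
  have heq : (fun z ↦ ρ ((chartAt E[d] x).symm z) •
      ℓ (chartAt E[d] x ((chartAt E[d] x).symm z))) =ᶠ[nhds (chartAt E[d] x x)] ℓ := by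
    filter_upwards [hρ, (chartAt E[d] x).open_target.mem_nhds (mem_chart_target E[d] x)]
      with z hz hzt
    rw [hz, (chartAt E[d] x).right_inv hzt, one_smul]
  refine (pderiv_congr heq).trans ?_
  rw [pderiv, ContinuousLinearMap.fderiv]
  simp [ℓ, EuclideanSpace.inner_single_right]

theorem metricInChart_eq_of_gradInner_eq [T2Space M] {g h : SmoothMetric d M}
    (hgh : ∀ (f : SmoothFun d M) (x : M), gradInner g f f x = gradInner h f f x) (x : M) :
    metricInChart g x (chartAt E[d] x x) = metricInChart h x (chartAt E[d] x x) := by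
  have hx := mem_chart_target E[d] x
  have hg := isLocalMetricOn_metricInChart g x
  have hh := isLocalMetricOn_metricInChart h x
  have hinv : (metricInChart g x (chartAt E[d] x x))⁻¹ =
      (metricInChart h x (chartAt E[d] x x))⁻¹ := by
    refine eq_of_dotProduct_mulVec_self_eq (hg.isSymm_inv hx) (hh.isSymm_inv hx) fun v ↦ ?_
    obtain ⟨f, hf⟩ := exists_smoothFun_pderiv_eq x (WithLp.toLp 2 v)
    simpa only [gradInner, localGradInner, hf, dotProduct, Matrix.mulVec, Finset.mul_sum,
      mul_left_comm, mul_comm, mul_assoc] using hgh f x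
  rw [← Matrix.nonsing_inv_nonsing_inv _ (hg.isUnit_det _ hx), hinv,
    Matrix.nonsing_inv_nonsing_inv _ (hh.isUnit_det _ hx)]

theorem chartSymmDeriv_surjective (x : M) {y : E[d]} (hy : y ∈ (chartAt E[d] x).target) :
    Function.Surjective (chartSymmDeriv x y) :=
  (mdifferentiable_chart (I := 𝓡 d) x).symm.mfderiv_surjective hy

theorem inner_eq_of_metricInChart_eq {g h : SmoothMetric d M} {x : M} {y : E[d]}
    (hy : y ∈ (chartAt E[d] x).target) (hgh : metricInChart g x y = metricInChart h x y) :
    g.inner ((chartAt E[d] x).symm y) = h.inner ((chartAt E[d] x).symm y) := by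
  ext v w
  obtain ⟨v, rfl⟩ := chartSymmDeriv_surjective x hy v
  obtain ⟨w, rfl⟩ := chartSymmDeriv_surjective x hy w
  rw [inner_chartSymmDeriv, inner_chartSymmDeriv, hgh]

theorem metric_eq_of_inner_eq {g h : SmoothMetric d M} (hgh : ∀ x, g.inner x = h.inner x) :
    g = h := by
  obtain ⟨_, _, _, _, _⟩ := g
  obtain ⟨_, _, _, _, _⟩ := h
  congr
  exact funext hgh

theorem metric_eq_of_gradInner_eq [T2Space M] {g h : SmoothMetric d M}
    (hgh : ∀ (f : SmoothFun d M) (x : M), gradInner g f f x = gradInner h f f x) : g = h := by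
  refine metric_eq_of_inner_eq fun x ↦ ?_
  have hx := inner_eq_of_metricInChart_eq (mem_chart_target E[d] x)
    (metricInChart_eq_of_gradInner_eq hgh x)
  rwa [(chartAt E[d] x).left_inv (mem_chart_source E[d] x)] at hx

variable [MeasurableSpace M] [BorelSpace M]

theorem weight_eq_of_withDensity_eq (g : SmoothMetric d M) {V W : SmoothFun d M}
    (h : (riemannianVolume g).withDensity (fun x ↦ ENNReal.ofReal (Real.exp (-V x))) =
      (riemannianVolume g).withDensity fun x ↦ ENNReal.ofReal (Real.exp (-W x))) : V = W := by
  have hcont (F : SmoothFun d M) : Continuous fun x ↦ ENNReal.ofReal (Real.exp (-F x)) :=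
    ENNReal.continuous_ofReal.comp (Real.continuous_exp.comp F.contMDiff.continuous.neg)
  ext x
  have hx := congrFun (eq_of_withDensity_eq_of_continuous (hcont V) (hcont W) h) x
  rwa [ENNReal.ofReal_eq_ofReal_iff (Real.exp_pos _).le (Real.exp_pos _).le, Real.exp_eq_exp,
    neg_inj] at hx

theorem WeightedStructure.toPair_injective [T2Space M] :
    Function.Injective (toPair : WeightedStructure d M → MeasureCarre d M) := by
  rintro ⟨g, V⟩ ⟨h, W⟩ hpair
  obtain rfl : g = h := metric_eq_of_gradInner_eq fun f x ↦
    congrFun (congrFun (congrArg MeasureCarre.carre hpair) f) x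
  obtain rfl : V = W := weight_eq_of_withDensity_eq g (congrArg MeasureCarre.measure hpair)
  rfl

theorem SGamma_toPair [T2Space M] (n γ : ℝ) (X : WeightedStructure d M) :
    SGamma n γ X.toPair = invariantFormula n γ X := by
  have h : ∃ Y : WeightedStructure d M, Y.toPair = X.toPair := ⟨X, rfl⟩
  rw [SGamma, dif_pos h, WeightedStructure.toPair_injective h.choose_spec]

end Uniqueness

section ConformalClass

variable {d : ℕ} {M : Type*} [TopologicalSpace M] [ChartedSpace E[d] M] [IsManifold (𝓡 d) ∞ M]

/-- The metric and weight of the pair `(c^{-n} μ, c² Γ)` with `c = e^τ`. Since the volume of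
`e^{-2τ} g` is `e^{-dτ} dV_g`, only the remaining factor `e^{-(n-d)τ}` goes into the weight. -/
noncomputable def WeightedStructure.conformal (X : WeightedStructure d M) (n : ℝ)
    (τ : SmoothFun d M) : WeightedStructure d M where
  metric := conformalMetric X.metric τ
  weight := ⟨fun x ↦ X.weight x + (n - d) * τ x,
    X.weight.contMDiff.add (contMDiff_const.mul τ.contMDiff)⟩

theorem invariantFormula_conformal {n γ : ℝ} (hn : n ≠ d)
    (hγ : 4 * ((d : ℝ) - 1) - 2 * γ * (n - d) ≠ 0) (X : WeightedStructure d M)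
    (τ : SmoothFun d M) (x : M) :
    invariantFormula n γ (X.conformal n τ) x = Real.exp (2 * τ x) * (invariantFormula n γ X x +
      (n - 2) / 2 * (X.generator τ x - (n - 2) / 2 * gradInner X.metric τ τ x)) := by
  have hn' : n - d ≠ 0 := sub_ne_zero.2 hn
  have hweight : ⇑(X.conformal n τ).weight = fun p ↦ X.weight p + (n - d) * τ p := rfl
  rw [invariantFormula, hweight, WeightedStructure.conformal, scalarCurvature_conformalMetric,
    laplacian_conformalMetric, gradInner_conformalMetric, laplacian_add_const_mul,
    gradInner_add_const_mul_self, gradInner_add_const_mul_right, gradInner_comm X.metric τ X.weight,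
    invariantFormula, WeightedStructure.generator, theta, beta]
  field_simp
  ring

variable [MeasurableSpace M] [BorelSpace M]

theorem withDensity_conformalMetric (g : SmoothMetric d M) (n : ℝ) (W τ : SmoothFun d M) :
    (riemannianVolume (conformalMetric g τ)).withDensity
        (fun x ↦ ENNReal.ofReal (Real.exp (-(W x + (n - d) * τ x)))) =
      ((riemannianVolume g).withDensity fun x ↦ ENNReal.ofReal (Real.exp (-W x))).withDensity
        fun x ↦ ENNReal.ofReal (Real.exp (τ x * -n)) := by
  have hW : Continuous W := W.contMDiff.continuous
  have hτ : Continuous τ := τ.contMDiff.continuous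
  rw [riemannianVolume_conformalMetric, ← withDensity_mul _ (by fun_prop) (by fun_prop),
    ← withDensity_mul _ (by fun_prop) (by fun_prop)]
  congr 1 with x
  rw [Pi.mul_apply, Pi.mul_apply, ← ENNReal.ofReal_mul (Real.exp_pos _).le,
    ← ENNReal.ofReal_mul (Real.exp_pos _).le, ← Real.exp_add, ← Real.exp_add]
  ring_nf

theorem WeightedStructure.toPair_conformal (X : WeightedStructure d M) (n : ℝ)
    {c τ : SmoothFun d M} (hc : ∀ x, c x = Real.exp (τ x)) :
    (X.conformal n τ).toPair = X.toPair.conformal n c := by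
  ext1
  · simp only [MeasureCarre.conformal, hc, ← Real.exp_mul]
    exact withDensity_conformalMetric X.metric n X.weight τ
  · ext f x
    have hsq : c x ^ 2 = Real.exp (2 * τ x) := by
      rw [hc, ← Real.exp_nat_mul, Nat.cast_ofNat]
    exact (gradInner_conformalMetric X.metric τ f f x).trans (by rw [← hsq]; rfl)

theorem exists_toPair_eq_of_mem_nConformalClass {n : ℝ} {X : WeightedStructure d M}
    {T : MeasureCarre d M} (hT : T ∈ nConformalClass n X.toPair) :
    ∃ Y : WeightedStructure d M, Y.toPair = T := by
  obtain ⟨c, hc, rfl⟩ := hT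
  have hlog : ContMDiff (𝓡 d) 𝓘(ℝ, ℝ) ∞ fun x ↦ Real.log (c x) := fun x ↦
    (Real.contDiffAt_log.2 (hc x).ne').contMDiffAt.comp x (c.contMDiff x)
  exact ⟨X.conformal n ⟨_, hlog⟩, X.toPair_conformal n fun x ↦ (Real.exp_log (hc x)).symm⟩

theorem isNConformalInvariant_SGamma [T2Space M] {n γ : ℝ} (hn : n ≠ d)
    (hγ : 4 * ((d : ℝ) - 1) - 2 * γ * (n - d) ≠ 0) (X : WeightedStructure d M) :
    IsNConformalInvariant n X (SGamma n γ) := by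
  intro Y _ c _ τ hτ x
  have hsq : Real.exp (τ x) ^ 2 = Real.exp (2 * τ x) := by
    rw [← Real.exp_nat_mul, Nat.cast_ofNat]
  rw [← Y.toPair_conformal n hτ, SGamma_toPair, SGamma_toPair, invariantFormula_conformal hn hγ,
    hτ, hsq]

end ConformalClass

end WeightedManifold

theorem proposition3_general {d : ℕ} {M : Type*} [TopologicalSpace M] [T2Space M]
    [ChartedSpace (EuclideanSpace ℝ (Fin d)) M] [IsManifold (𝓡 d) ∞ M]
    [MeasurableSpace M] [BorelSpace M]
    (n γ : ℝ) (hn : n ≠ d) (hγ : 4 * ((d : ℝ) - 1) - 2 * γ * (n - d) ≠ 0)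
    (X : WeightedManifold.WeightedStructure d M) :
    (∀ T ∈ WeightedManifold.nConformalClass n X.toPair,
      ∃ Y : WeightedManifold.WeightedStructure d M, Y.toPair = T) ∧
    (∀ (Y : WeightedManifold.WeightedStructure d M) (x : M),
      WeightedManifold.SGamma n γ Y.toPair x =
        WeightedManifold.theta d n γ *
          (WeightedManifold.scalarCurvature Y.metric x
            - γ * WeightedManifold.laplacian Y.metric Y.weight x
            + WeightedManifold.beta d n γ *
              WeightedManifold.gradInner Y.metric Y.weight Y.weight x)) ∧
    WeightedManifold.IsNConformalInvariant n X (WeightedManifold.SGamma n γ) :=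
  ⟨fun _ hT ↦ WeightedManifold.exists_toPair_eq_of_mem_nConformalClass hT,
    fun Y x ↦ congrFun (WeightedManifold.SGamma_toPair n γ Y) x,
    WeightedManifold.isNConformalInvariant_SGamma hn hγ X⟩

theorem proposition3 {d : ℕ} (hd : 2 ≤ d)
    {M : Type*} [TopologicalSpace M] [T2Space M] [SecondCountableTopology M]
    [ChartedSpace (EuclideanSpace ℝ (Fin d)) M] [IsManifold (𝓡 d) ∞ M]
    [MeasurableSpace M] [BorelSpace M]
    (n γ : ℝ) (hn : (d : ℝ) < n) (hγ : 4 * ((d : ℝ) - 1) - 2 * γ * (n - d) ≠ 0)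
    (X : WeightedManifold.WeightedStructure d M) :
    (∀ T ∈ WeightedManifold.nConformalClass n X.toPair,
      ∃ Y : WeightedManifold.WeightedStructure d M, Y.toPair = T) ∧
    (∀ (Y : WeightedManifold.WeightedStructure d M) (x : M),
      WeightedManifold.SGamma n γ Y.toPair x =
        WeightedManifold.theta d n γ *
          (WeightedManifold.scalarCurvature Y.metric x
            - γ * WeightedManifold.laplacian Y.metric Y.weight x
            + WeightedManifold.beta d n γ *
              WeightedManifold.gradInner Y.metric Y.weight Y.weight x)) ∧
    WeightedManifold.IsNConformalInvariant n X (WeightedManifold.SGamma n γ) :=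
  proposition3_general n γ hn.ne' hγ X
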